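/- Let $E$ be a real inner product space of dimension $k$, with a direct sum decomposition $E = P \oplus N$ into a physical space $P$ of dimension $d$ and an internal space $N$ of dimension $k-d$, where $0<d<k$. Let $\pi_\vee : E \to P$ and $\pi_< : E \to N$ be the associated projections. Let $W \subset N$ be a polytopal window: compact, with non-empty interior, and equal to the intersection of a finite irredundant family $\mathscr{H}^+$ of closed half-spaces of $N$; let $\mathscr{H}$ be the set of their bounding affine hyperplanes. For a lattice $\Gamma$ in $E$ and $H \in \mathscr{H}$ put $\Gamma^H = \{\gamma\in\Gamma : H + \pi_<(\gamma) = H\}$. A parameter $s \in E$ is non-singular for $\Gamma$ if $\pi_<(\Gamma+s) \cap \partial W = \emptyset$, and then $\Lambda_s = \{\pi_\vee(x) : x \in \Gamma+s,\ \pi_<(x)\in W\}$ is the associated cut and project set. For $r>0$ and $y \in \Lambda_s$, the $r$-patch at $y$ is the set of points of $\Lambda_s$ at distance at most $r$ from $y$, with $y$ as marked origin, and $p(r)$ is the number of $r$-patches of $\Lambda_s$ up to translation. Then for almost every lattice $\Gamma$ in $E$, with respect to Haar measure on the space of lattices, the following hold: $\pi_\vee$ is injective on $\Gamma$; $\pi_<(\Gamma)$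 is dense in $N$; $\Gamma^H$ is trivial for every $H \in \mathscr{H}$; and for every non-singular parameter $s$ the complexity function of $\Lambda_s$ is finite and satisfies $p(r) \asymp r^{d(k-d)}$ as $r \to \infty$, that is, there are constants $c, C > 0$ with $c\, r^{d(k-d)} \le p(r) \le C\, r^{d(k-d)}$ for all sufficiently large $r$. Here the space of lattices $GL_k(\mathbb{R})/GL_k(\mathbb{Z})$ carries the quotient topology, and "Haar measure" may be taken to be any non-zero Borel measure on it that is a countable sum of finite measures and is invariant under the linear automorphisms of $E$ of determinant one; this includes the Haar measure on the space of all lattices as well as the Haar measure on the lattices of any fixed covolume. -/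

import Mathlib

open MeasureTheory Filter Topology Module
open scoped Pointwise

/-! ### The space of lattices of a finite-dimensional real vector space -/

section LatticeSpace

variable (E : Type*) [NormedAddCommGroup E] [InnerProductSpace ℝ E] [FiniteDimensional ℝ E]

/-- A lattice in `E`: a discrete subgroup that spans `E` over `ℝ` (equivalently, a discrete
co-compact subgroup). -/
structure LatticeSpace where
  toSubmodule : Submodule ℤ E
  discrete : DiscreteTopology toSubmodule
  isZLattice : IsZLattice ℝ toSubmodule

variable {E}

/-- The lattice generated over `ℤ` by a real basis of `E`. -/
noncomputable def LatticeSpace.ofBasis (b : Basis (Fin (finrank ℝ E)) ℝ E) : LatticeSpace E where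
  toSubmodule := Submodule.span ℤ (Set.range b)
  discrete := inferInstance
  isZLattice := inferInstance

/-- The action of linear automorphisms of `E` on lattices: the image lattice `g Γ`, written as the
preimage of `Γ` under `g⁻¹`. -/
noncomputable def LatticeSpace.map (g : E ≃L[ℝ] E) (Γ : LatticeSpace E) : LatticeSpace E :=
  haveI := Γ.discrete
  haveI := Γ.isZLattice
  { toSubmodule := ZLattice.comap ℝ Γ.toSubmodule g.symm.toLinearMap
    discrete := inferInstance
    isZLattice := inferInstance }

/-- The quotient topology on the space of lattices `GL_k(ℝ) / GL_k(ℤ)`: the topology coinduced from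
the space of (ordered) bases of `E`, the latter being topologised as a subspace of `E ^ k`. -/
noncomputable instance : TopologicalSpace (LatticeSpace E) :=
  TopologicalSpace.coinduced LatticeSpace.ofBasis
    (TopologicalSpace.induced
      (fun (b : Basis (Fin (finrank ℝ E)) ℝ E) => (b : Fin (finrank ℝ E) → E)) Pi.topologicalSpace)

noncomputable instance : MeasurableSpace (LatticeSpace E) := borel _

instance : BorelSpace (LatticeSpace E) := ⟨rfl⟩

/-- `μ` is a Haar measure on the space of lattices: a nonzero Borel measure, a countable sum of
finite measures, and invariant under the linear automorphisms of determinant one. Both the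
`GL(E)`-invariant Haar measure on the space of all lattices and the `SL(E)`-invariant Haar measure
carried by the lattices of a fixed covolume are of this kind. -/
structure IsHaarOnLattices (μ : Measure (LatticeSpace E)) : Prop where
  ne_zero : μ ≠ 0
  sFinite : SFinite μ
  invariant : ∀ g : E ≃L[ℝ] E, LinearMap.det (g : E →ₗ[ℝ] E) = 1 →
    MeasurePreserving (LatticeSpace.map g) μ μ

end LatticeSpace

/-! ### Polytopal windows -/

section Polytopal

variable {U : Type*} [NormedAddCommGroup U] [InnerProductSpace ℝ U]

def affineHyperplane (η α : U) : Set U := {x | inner ℝ (x - α) η = 0}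

def halfSpace (η α : U) : Set U := {x | 0 ≤ inner ℝ (x - α) η}

/-- `W` is polytopal with set of defining half-spaces `𝓢`: it is compact, has non-empty interior and
is the intersection of the finite, irredundant family `𝓢` of half-spaces. -/
structure IsPolytopalWindow (W : Set U) (𝓢 : Set (Set U)) : Prop where
  isCompact : IsCompact W
  interior_nonempty : (interior W).Nonempty
  finite : 𝓢.Finite
  isHalfSpace : ∀ S ∈ 𝓢, ∃ η α : U, η ≠ 0 ∧ S = halfSpace η α
  sInter_eq : ⋂₀ 𝓢 = W
  irredundant : ∀ S ∈ 𝓢, ⋂₀ (𝓢 \ {S}) ≠ W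

/-- The affine hyperplanes bounding the half-spaces in `𝓢`. -/
def boundingHyperplanes (𝓢 : Set (Set U)) : Set (Set U) :=
  {H | ∃ η α : U, η ≠ 0 ∧ halfSpace η α ∈ 𝓢 ∧ H = affineHyperplane η α}

end Polytopal

/-! ### Cut and project sets

`P` is the physical space and `N` the internal space of the total space `E = P ⊕ N`. -/

section CutAndProject

variable {E : Type*} [NormedAddCommGroup E] [InnerProductSpace ℝ E]
  {P N : Submodule ℝ E}

/-- The projection to the physical space along the internal space. -/
noncomputable def projPhys (hPN : IsCompl P N) : E →ₗ[ℝ] P := P.projectionOnto N hPN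

/-- The projection to the internal space along the physical space. -/
noncomputable def projInt (hPN : IsCompl P N) : E →ₗ[ℝ] N := N.projectionOnto P hPN.symm

/-- The stabiliser `Γ^H = {γ ∈ Γ | H + γ_< = H}`. -/
noncomputable def latticeStabiliser (hPN : IsCompl P N) (Γ : LatticeSpace E) (H : Set N) :
    AddSubgroup E :=
  Γ.toSubmodule.toAddSubgroup ⊓
    (AddAction.stabilizer N H).comap (projInt hPN).toAddMonoidHom

/-- `s` is non-singular: no point of `Γ + s` projects into the boundary of the window. -/
def IsNonsingular (hPN : IsCompl P N) (Γ : LatticeSpace E) (W : Set N) (s : E) : Prop :=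
  ∀ γ ∈ Γ.toSubmodule, projInt hPN (γ + s) ∉ frontier W

/-- The cut and project set with parameter `s`. -/
def cutAndProject (hPN : IsCompl P N) (Γ : LatticeSpace E) (W : Set N) (s : E) : Set P :=
  {y | ∃ γ ∈ Γ.toSubmodule, projInt hPN (γ + s) ∈ W ∧ y = projPhys hPN (γ + s)}

/-- The `r`-patch of `Λ` at `y`, translated so that its marked point `y` is the origin. Two
`r`-patches are translation equivalent iff these sets are equal. -/
def centredPatch {V : Type*} [NormedAddCommGroup V] (Λ : Set V) (y : V) (r : ℝ) : Set V :=
  (fun x => x - y) '' (Λ ∩ Metric.closedBall y r)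

/-- The set of translation classes of `r`-patches of `Λ`. -/
def patchClasses {V : Type*} [NormedAddCommGroup V] (Λ : Set V) (r : ℝ) : Set (Set V) :=
  (fun y => centredPatch Λ y r) '' Λ

/-- The complexity function `p(r)`: the number of translation classes of `r`-patches. -/
noncomputable def complexity {V : Type*} [NormedAddCommGroup V] (Λ : Set V) (r : ℝ) : ℕ :=
  (patchClasses Λ r).ncard

end CutAndProject

/-!
Two linear conditions on a lattice `Γ` carry everything. For a nonzero functional `ψ` on `E`,
almost every `Γ` has no nonzero point in `ker ψ` (`IsHaarOnLattices.ae_forall_eq_zero`). For a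
nonzero vector `v`, almost every `Γ` has no nonzero functional that is integral on `Γ` and
vanishes at `v` (`IsHaarOnLattices.ae_forall_functional_eq_zero`). Both follow from invariance
alone. Restrict the offending point or functional to a compact set `K`; the set `B` of offending
lattices is then measurable. Along a curve of transvections `g_t`, `0 ≤ t ≤ 1`, the condition that
a given point or functional offends after moving by `g_t` is a nonzero polynomial equation in `t`,
so every lattice lies in `g_t⁻¹ B` for finitely many `t` only. An uncountable point-finite family
of measurable sets contains a null set (`exists_measure_eq_zero_of_pointFinite`), and all the
`g_t⁻¹ B` have the measure of `B`.

The first condition, with `ψ` vanishing on `N`, gives injectivity of `π_∨`. With `ψ` the composite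
of `π_<` and a facet normal, it shows that no nonzero `γ_<` is parallel to a facet. The second,
with `v ∈ P`, gives density of `π_<(Γ)` by Kronecker's criterion
(`AddSubgroup.dense_of_forall_functional`): a closed proper subgroup that spans is a lattice
modulo the lines it contains.

Write `n = k - d`. The patch at a point with internal coordinate `y` records the `γ ∈ Γ` with
`‖γ_∨‖ ≤ r` and `y + γ_< ∈ W`, and only the `O(r ^ d)` lattice points with `γ_< ∈ W - W` matter.
For the upper bound, the patch is determined by the position of `y` relative to `O(r ^ d)`
half-spaces of `N`, and `M` half-spaces of an `n`-dimensional space cut out at most `(M + 1) ^ n`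
patterns, by the Sauer-Shelah lemma (`ncard_halfSpace_patterns_le`). For the lower bound
(`exists_le_complexity`), take `n` facets with independent normals. Density of `π_<(Γ)` provides
for each of them at least `c * r ^ d` lattice points whose translates move the facet across a
fixed small box inside `W`, and these translates are distinct because no `γ_<` is parallel to the
facet. They cut the box into at least `(c * r ^ d) ^ n` cells. Each cell contains the internal
coordinate of a point of `Γ + s`, and different cells give different patches.
-/

/-! ### Lattices and bases -/

section LatticeBasics

variable {E : Type*} [NormedAddCommGroup E] [InnerProductSpace ℝ E]

theorem LatticeSpace.exists_basis [FiniteDimensional ℝ E] (Γ : LatticeSpace E) :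
    ∃ b : Basis (Fin (finrank ℝ E)) ℝ E, Γ.toSubmodule = Submodule.span ℤ (Set.range b) := by
  have := Γ.discrete
  have := Γ.isZLattice
  have hr : finrank ℤ Γ.toSubmodule = finrank ℝ E := ZLattice.rank ℝ Γ.toSubmodule
  let b₀ : Basis (Fin (finrank ℝ E)) ℤ Γ.toSubmodule :=
    (Module.finBasis ℤ Γ.toSubmodule).reindex (finCongr hr)
  exact ⟨b₀.ofZLatticeBasis ℝ Γ.toSubmodule, (b₀.ofZLatticeBasis_span ℝ Γ.toSubmodule).symm⟩

theorem LatticeSpace.finite_inter [FiniteDimensional ℝ E] (Γ : LatticeSpace E) {s : Set E}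
    (hs : Bornology.IsBounded s) :
    (s ∩ (Γ.toSubmodule : Set E)).Finite := by
  obtain ⟨b, hb⟩ := Γ.exists_basis
  rw [hb]
  exact ZSpan.setFinite_inter b hs

/-- A lattice is co-compact: every point is within a fixed distance of the lattice. -/
theorem LatticeSpace.exists_covering_radius [FiniteDimensional ℝ E] (Γ : LatticeSpace E) :
    ∃ R : ℝ, ∀ x : E, ∃ γ ∈ Γ.toSubmodule, ‖γ - x‖ ≤ R := by
  obtain ⟨b, hb⟩ := Γ.exists_basis
  rw [hb]
  refine ⟨∑ i, ‖b i‖, fun x => ⟨ZSpan.floor b x, (ZSpan.floor b x).2, ?_⟩⟩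
  rw [norm_sub_rev]
  exact ZSpan.norm_fract_le b x

/-- Only finitely many members of a bounded set of functionals are integral on a given lattice. -/
theorem LatticeSpace.finite_integral_functionals [FiniteDimensional ℝ E] (Γ : LatticeSpace E)
    {K : Set (E →L[ℝ] ℝ)} (hK : Bornology.IsBounded K) :
    {φ | φ ∈ K ∧ ∀ γ ∈ Γ.toSubmodule, φ γ ∈ Set.range ((↑) : ℤ → ℝ)}.Finite := by
  obtain ⟨b, hb⟩ := Γ.exists_basis
  obtain ⟨C, hC⟩ := hK.exists_norm_le
  have hbΓ : ∀ i, b i ∈ Γ.toSubmodule := fun i =>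
    hb ▸ Submodule.subset_span (Set.mem_range_self i)
  -- an integral functional is determined by its integer values on a basis, and these are bounded
  refine Set.Finite.of_finite_image (f := fun φ i => ⌊φ (b i)⌋)
    ((Set.Finite.pi' (fun i => Set.finite_Icc (-⌈C * ‖b i‖⌉) ⌈C * ‖b i‖⌉)).subset ?_) ?_
  · rintro _ ⟨φ, ⟨hφ, hint⟩, rfl⟩ i
    obtain ⟨n, hn⟩ := hint _ (hbΓ i)
    have h1 : |φ (b i)| ≤ ⌈C * ‖b i‖⌉ := by
      refine ((φ.le_opNorm (b i)).trans ?_).trans (Int.le_ceil _)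
      exact mul_le_mul_of_nonneg_right (hC φ hφ) (norm_nonneg _)
    simp only [← hn, Int.floor_intCast]
    rw [← hn] at h1
    exact abs_le.mp (by exact_mod_cast h1)
  · rintro φ ⟨-, hφ⟩ ψ ⟨-, hψ⟩ h
    refine ContinuousLinearMap.coe_injective (b.ext fun i => ?_)
    obtain ⟨n, hn⟩ := hφ _ (hbΓ i)
    obtain ⟨m, hm⟩ := hψ _ (hbΓ i)
    have := congrFun h i
    simp only [← hn, ← hm, Int.floor_intCast] at this
    simp [← hn, ← hm, this]

theorem LatticeSpace.mem_map_iff (g : E ≃L[ℝ] E) (Γ : LatticeSpace E) (x : E) :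
    x ∈ (LatticeSpace.map g Γ).toSubmodule ↔ g.symm x ∈ Γ.toSubmodule := Iff.rfl

end LatticeBasics

/-! ### Measurable sets of lattices -/

section LatticeMeasurable

variable {E : Type*} [NormedAddCommGroup E] [InnerProductSpace ℝ E]

theorem LatticeSpace.isOpen_setOf_meets {U : Set E} (hU : IsOpen U) :
    IsOpen {Γ : LatticeSpace E | ∃ γ ∈ Γ.toSubmodule, γ ∈ U} := by
  rw [isOpen_coinduced, isOpen_induced_iff]
  refine ⟨⋃ m : Fin (finrank ℝ E) → ℤ, {v | ∑ i, m i • v i ∈ U},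
    isOpen_iUnion fun m => hU.preimage (by fun_prop), ?_⟩
  ext b
  simp only [Set.mem_preimage, Set.mem_iUnion, Set.mem_ofPred_eq, LatticeSpace.ofBasis]
  constructor
  · rintro ⟨m, hm⟩
    exact ⟨_, (Submodule.mem_span_range_iff_exists_fun ℤ).2 ⟨m, rfl⟩, hm⟩
  · rintro ⟨γ, hγ, hU⟩
    obtain ⟨m, rfl⟩ := (Submodule.mem_span_range_iff_exists_fun ℤ).1 hγ
    exact ⟨m, hU⟩

/-- The lattices meeting a compact set form a `G_δ`: by discreteness, a lattice meets `K` as soon as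
it meets every thickening of `K`. -/
theorem LatticeSpace.measurableSet_setOf_meets [FiniteDimensional ℝ E] {K : Set E}
    (hK : IsCompact K) :
    MeasurableSet {Γ : LatticeSpace E | ∃ γ ∈ Γ.toSubmodule, γ ∈ K} := by
  have h : {Γ : LatticeSpace E | ∃ γ ∈ Γ.toSubmodule, γ ∈ K} =
      ⋂ n : ℕ, {Γ : LatticeSpace E |
        ∃ γ ∈ Γ.toSubmodule, γ ∈ Metric.thickening (1 / ((n : ℝ) + 1)) K} := by
    ext Γ
    simp only [Set.mem_ofPred_eq, Set.mem_iInter]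
    constructor
    · rintro ⟨γ, hγ, hK'⟩ n
      exact ⟨γ, hγ, Metric.self_subset_thickening (by positivity) K hK'⟩
    · intro h
      by_contra! hcon
      have hfin := Γ.finite_inter (hK.isBounded.thickening (δ := 1))
      have hev : ∀ᶠ n : ℕ in atTop, ∀ γ ∈ Metric.thickening 1 K ∩ (Γ.toSubmodule : Set E),
          γ ∉ Metric.thickening (1 / ((n : ℝ) + 1)) K := by
        rw [hfin.eventually_all]
        rintro γ ⟨-, hγ⟩
        have hpos : 0 < Metric.infEDist γ K := by
          rw [pos_iff_ne_zero, Ne, ← Metric.mem_closure_iff_infEDist_zero, hK.isClosed.closure_eq]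
          exact hcon γ hγ
        have ht : Tendsto (fun n : ℕ => ENNReal.ofReal (1 / ((n : ℝ) + 1))) atTop (𝓝 0) := by
          simpa using ENNReal.tendsto_ofReal tendsto_one_div_add_atTop_nhds_zero_nat
        filter_upwards [ht.eventually_lt_const hpos] with n hn hmem
        exact absurd (Metric.mem_thickening_iff_infEDist_lt.1 hmem) hn.not_gt
      obtain ⟨n, hn⟩ := hev.exists
      obtain ⟨γ, hγ, hγn⟩ := h n
      refine hn γ ⟨Metric.thickening_mono ?_ K hγn, hγ⟩ hγn
      rw [div_le_one (by positivity)]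
      linarith [n.cast_nonneg (α := ℝ)]
  rw [h]
  exact MeasurableSet.iInter fun n =>
    (LatticeSpace.isOpen_setOf_meets Metric.isOpen_thickening).measurableSet

/-- The lattices on which some member of a compact set of functionals is integral form a closed set,
being the projection along a compact factor of a closed set of pairs. -/
theorem LatticeSpace.isClosed_setOf_integral {K : Set (E →L[ℝ] ℝ)} (hK : IsCompact K) :
    IsClosed {Γ : LatticeSpace E |
      ∃ φ ∈ K, ∀ γ ∈ Γ.toSubmodule, φ γ ∈ Set.range ((↑) : ℤ → ℝ)} := by
  rw [isClosed_coinduced, isClosed_induced_iff]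
  have : CompactSpace K := isCompact_iff_compactSpace.1 hK
  refine ⟨Prod.snd '' {p : K × (Fin (finrank ℝ E) → E) |
      ∀ i, (p.1 : E →L[ℝ] ℝ) (p.2 i) ∈ Set.range ((↑) : ℤ → ℝ)},
    isClosedMap_snd_of_compactSpace _ ?_, ?_⟩
  · rw [Set.ofPred_forall]
    exact isClosed_iInter fun i => Int.isClosedEmbedding_coe_real.isClosed_range.preimage
      (by fun_prop)
  · ext b
    simp only [Set.mem_preimage, Set.mem_image, Set.mem_ofPred_eq, LatticeSpace.ofBasis]
    constructor
    · rintro ⟨⟨φ, v⟩, h, rfl⟩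
      refine ⟨φ, φ.2, fun γ hγ => ?_⟩
      obtain ⟨m, rfl⟩ := (Submodule.mem_span_range_iff_exists_fun ℤ).1 hγ
      choose n hn using h
      exact ⟨∑ i, m i * n i, by simp [← hn]⟩
    · rintro ⟨φ, hφ, h⟩
      exact ⟨(⟨φ, hφ⟩, b), fun i => h _ (Submodule.subset_span (Set.mem_range_self i)), rfl⟩

end LatticeMeasurable

/-! ### Null sets by moving a set off itself -/

section NullSets

/-- An uncountable point-finite family of measurable sets contains a set of measure zero. -/
theorem exists_measure_eq_zero_of_pointFinite {X ι : Type*} [MeasurableSpace X] [Uncountable ι]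
    (μ : Measure X) [SFinite μ] {A : ι → Set X} (hA : ∀ t, MeasurableSet (A t))
    (hfin : ∀ x, {t | x ∈ A t}.Finite) : ∃ t, μ (A t) = 0 := by
  suffices h : ∃ t, μ.toFinite (A t) = 0 by
    obtain ⟨t, ht⟩ := h
    exact ⟨t, absolutelyContinuous_toFinite μ ht⟩
  set ν := μ.toFinite
  by_contra! hpos
  -- infinitely many of the sets have measure bounded below
  obtain ⟨n, hn⟩ : ∃ n : ℕ, {t | ((n : ENNReal) + 1)⁻¹ < ν (A t)}.Infinite := by
    by_contra! hcon
    have hcover : (Set.univ : Set ι) ⊆ ⋃ n : ℕ, {t | ((n : ENNReal) + 1)⁻¹ < ν (A t)} := by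
      intro t _
      obtain ⟨n, hn⟩ := ENNReal.exists_inv_nat_lt (hpos t)
      refine Set.mem_iUnion.2 ⟨n, lt_of_le_of_lt ?_ hn⟩
      exact ENNReal.inv_le_inv.2 le_self_add
    have : (Set.univ : Set ι).Countable :=
      (Set.countable_iUnion fun n => (hcon n).countable).mono hcover
    exact not_countable (α := ι) (Set.countable_univ_iff.1 this)
  set e := hn.natEmbedding
  -- the tails of the corresponding sequence decrease to the empty set
  have hlim : Tendsto (fun m : ℕ => ν (⋃ j ≥ m, A (e j))) atTop
      (𝓝 (ν (⋂ m : ℕ, ⋃ j ≥ m, A (e j)))) := by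
    refine tendsto_measure_iInter_atTop
      (fun m =>
        (MeasurableSet.iUnion fun j => MeasurableSet.iUnion fun _ => hA _).nullMeasurableSet)
      ?_ ⟨0, measure_ne_top _ _⟩
    intro m m' hmm'
    exact Set.iUnion_mono fun j => Set.iUnion_mono' fun hj => ⟨le_trans hmm' hj, le_rfl⟩
  have hempty : (⋂ m : ℕ, ⋃ j ≥ m, A (e j)) = ∅ := by
    refine Set.eq_empty_of_forall_notMem fun x hx => ?_
    have hfin' : {j : ℕ | x ∈ A (e j)}.Finite := by
      refine ((hfin x).preimage (f := fun j => ((e j : _) : ι)) ?_)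
      exact (Subtype.val_injective.comp e.injective).injOn
    obtain ⟨m, hm⟩ := hfin'.bddAbove
    obtain ⟨j, hj, hxj⟩ : ∃ j ≥ m + 1, x ∈ A (e j) := by
      simpa using Set.mem_iInter.1 hx (m + 1)
    have := hm hxj
    omega
  rw [hempty, measure_empty] at hlim
  have hle : ((n : ENNReal) + 1)⁻¹ ≤ 0 := by
    refine ge_of_tendsto' hlim fun m => ?_
    refine (e m).2.le.trans (measure_mono ?_)
    exact Set.subset_biUnion_of_mem (u := fun j => A (e j)) (le_refl m)
  exact (ENNReal.inv_pos.2 (by simp [ENNReal.add_eq_top])).not_ge hle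

/-- A measurable set is null if an uncountable family of measure preserving maps moves it around
so that every point is covered only finitely often. -/
theorem measure_eq_zero_of_pointFinite_preimages {X ι : Type*} [MeasurableSpace X] [Uncountable ι]
    {μ : Measure X} [SFinite μ] {B : Set X} (hB : MeasurableSet B) {T : ι → X → X}
    (hT : ∀ t, MeasurePreserving (T t) μ μ) (hfin : ∀ x, {t | T t x ∈ B}.Finite) : μ B = 0 := by
  obtain ⟨t, ht⟩ := exists_measure_eq_zero_of_pointFinite μ (A := fun t => T t ⁻¹' B)
    (fun t => (hT t).measurable hB) hfin
  rwa [(hT t).measure_preimage hB.nullMeasurableSet] at ht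

end NullSets

/-! ### Curves of transvections -/

section Transvections

theorem finite_setOf_sum_pow_eq_zero {n : ℕ} {c : Fin n → ℝ} (hc : ∃ j, c j ≠ 0) :
    {t : ℝ | ∑ j : Fin n, t ^ (j : ℕ) * c j = 0}.Finite := by
  set p : Polynomial ℝ := ∑ j : Fin n, Polynomial.C (c j) * Polynomial.X ^ (j : ℕ)
  have hp : p ≠ 0 := by
    obtain ⟨j, hj⟩ := hc
    intro h
    apply hj
    have := congrArg (fun q => Polynomial.coeff q (j : ℕ)) h
    simpa [p, Polynomial.finsetSum_coeff, Polynomial.coeff_C_mul, Polynomial.coeff_X_pow,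
      Fin.val_inj] using this
  refine (Polynomial.finite_setOfPred_isRoot hp).subset fun t ht => ?_
  change p.eval t = 0
  rw [← show ∑ j : Fin n, t ^ (j : ℕ) * c j = 0 from ht, Polynomial.eval_finsetSum]
  simp only [Polynomial.eval_mul, Polynomial.eval_C, Polynomial.eval_pow, Polynomial.eval_X,
    mul_comm]

theorem exists_basis_apply_eq {V : Type*} [AddCommGroup V] [Module ℝ V] [FiniteDimensional ℝ V]
    {v : V} (hv : v ≠ 0) :
    ∃ (b : Basis (Fin (finrank ℝ V)) ℝ V) (i₀ : Fin (finrank ℝ V)), (i₀ : ℕ) = 0 ∧ b i₀ = v := by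
  have hli : LinearIndepOn ℝ id ({v} : Set V) := LinearIndepOn.singleton hv
  let b := Basis.extend hli
  have hmem : v ∈ hli.extend (Set.subset_univ _) := hli.subset_extend _ rfl
  have hfin : Finite (hli.extend (Set.subset_univ _)) := Module.Finite.finite_basis b
  have := Fintype.ofFinite (hli.extend (Set.subset_univ _))
  have hcard : Fintype.card (hli.extend (Set.subset_univ _)) = finrank ℝ V :=
    (finrank_eq_card_basis b).symm
  have hpos : 0 < finrank ℝ V := finrank_pos_iff_exists_ne_zero.2 ⟨v, hv⟩
  let e := Fintype.equivFinOfCardEq hcard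
  let i₀ : Fin (finrank ℝ V) := ⟨0, hpos⟩
  refine ⟨b.reindex (e.trans (Equiv.swap (e ⟨v, hmem⟩) i₀)), i₀, rfl, ?_⟩
  simp [b]

theorem exists_basis_coord_eq {V : Type*} [AddCommGroup V] [Module ℝ V] [FiniteDimensional ℝ V]
    {ψ : Dual ℝ V} (hψ : ψ ≠ 0) :
    ∃ (b : Basis (Fin (finrank ℝ V)) ℝ V) (i₀ : Fin (finrank ℝ V)),
      (i₀ : ℕ) = 0 ∧ b.coord i₀ = ψ := by
  obtain ⟨b', i', hi', hb'⟩ := exists_basis_apply_eq hψ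
  have hr : finrank ℝ (Dual ℝ V) = finrank ℝ V := Subspace.dual_finrank_eq
  let b'' := b'.reindex (finCongr hr)
  refine ⟨b''.dualBasis.map (evalEquiv ℝ V).symm, finCongr hr i', by simpa using hi', ?_⟩
  ext x
  rw [← hb']
  simp only [b'', Basis.coord_apply, Basis.map_repr, LinearEquiv.trans_apply,
    LinearEquiv.symm_symm, Basis.dualBasis_repr]
  simp

variable {E : Type*} [NormedAddCommGroup E] [InnerProductSpace ℝ E] [FiniteDimensional ℝ E]

/-- Transvections act on the space of lattices by measure preserving maps. -/
theorem IsHaarOnLattices.measurePreserving_transvection {μ : Measure (LatticeSpace E)}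
    (hμ : IsHaarOnLattices μ) {f : Dual ℝ E} {v : E} (h : f v = 0) :
    MeasurePreserving
      (LatticeSpace.map (LinearEquiv.transvection h).toContinuousLinearEquiv) μ μ := by
  refine hμ.invariant _ ?_
  have : ((LinearEquiv.transvection h).toContinuousLinearEquiv : E →ₗ[ℝ] E) =
      LinearMap.transvection f v := rfl
  rw [this, LinearMap.transvection.det, h, add_zero]

/-- The set of nonzero points of `{f = 0}` is exhausted by these compact sets. -/
theorem isCompact_setOf_eq_zero_annulus {V : Type*} [NormedAddCommGroup V] [ProperSpace V]
    {f : V → ℝ} (hf : Continuous f) (n : ℕ) :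
    IsCompact {x : V | f x = 0 ∧ ‖x‖ ≤ n ∧ 1 ≤ (n : ℝ) * ‖x‖} := by
  refine (isCompact_closedBall (0 : V) n).of_isClosed_subset ?_ ?_
  · exact (isClosed_eq hf continuous_const).inter
      ((isClosed_le continuous_norm continuous_const).inter
        (isClosed_le continuous_const (continuous_const.mul continuous_norm)))
  · rintro x ⟨-, hx, -⟩
    simpa using hx

theorem exists_mem_annulus {V : Type*} [NormedAddCommGroup V] {x : V} (hx : x ≠ 0) :
    ∃ n : ℕ, ‖x‖ ≤ n ∧ 1 ≤ (n : ℝ) * ‖x‖ := by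
  obtain ⟨n, hn⟩ := exists_nat_ge (max ‖x‖ (1 / ‖x‖))
  refine ⟨n, (le_max_left _ _).trans hn, ?_⟩
  have hpos : 0 < ‖x‖ := norm_pos_iff.2 hx
  exact (div_le_iff₀ hpos).1 ((le_max_right _ _).trans hn)

/-- Finitely many points, each of which is hit at finitely many real parameters, are hit at finitely
many parameters in the unit interval altogether. -/
theorem finite_setOf_unitInterval {Y : Type*} {S : Set Y} (hS : S.Finite) {Q : ℝ → Y → Prop}
    (hQ : ∀ y ∈ S, {t | Q t y}.Finite) : {t : unitInterval | ∃ y ∈ S, Q t y}.Finite := by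
  have : {t : ℝ | ∃ y ∈ S, Q t y}.Finite := by
    refine (hS.biUnion hQ).subset ?_
    rintro t ⟨y, hy, h⟩
    exact Set.mem_biUnion hy h
  exact this.preimage (f := (Subtype.val : unitInterval → ℝ)) Subtype.val_injective.injOn

instance : Uncountable unitInterval := by
  rw [← Cardinal.aleph0_lt_mk_iff, unitInterval, Cardinal.mk_Icc_real zero_lt_one]
  exact Cardinal.aleph0_lt_continuum

/-- Almost every lattice has no nonzero point in a given hyperplane through the origin. The
transvections `x ↦ x + (∑ t ^ j x_j) e₀` move the hyperplane `x₀ = 0` to the hyperplanes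
`∑ t ^ j x_j = 0`, of which every nonzero vector lies in only finitely many. -/
theorem IsHaarOnLattices.ae_forall_eq_zero {μ : Measure (LatticeSpace E)}
    (hμ : IsHaarOnLattices μ) {ψ : Dual ℝ E} (hψ : ψ ≠ 0) :
    ∀ᵐ Γ : LatticeSpace E ∂μ, ∀ γ ∈ Γ.toSubmodule, ψ γ = 0 → γ = 0 := by
  have := hμ.sFinite
  obtain ⟨b, i₀, hi₀, rfl⟩ := exists_basis_coord_eq hψ
  let K : ℕ → Set E := fun n => {x | b.coord i₀ x = 0 ∧ ‖x‖ ≤ n ∧ 1 ≤ (n : ℝ) * ‖x‖}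
  have hK : ∀ n, IsCompact (K n) := fun n =>
    isCompact_setOf_eq_zero_annulus (b.coord i₀).continuous_of_finiteDimensional n
  let f : ℝ → Dual ℝ E := fun t => ∑ j ∈ Finset.univ.erase i₀, t ^ (j : ℕ) • b.coord j
  have hf : ∀ t, f t (b i₀) = 0 := by
    intro t
    simp only [f, LinearMap.sum_apply, LinearMap.smul_apply]
    refine Finset.sum_eq_zero fun j hj => ?_
    simp [(Finset.ne_of_mem_erase hj).symm]
  have hnull : ∀ n, μ {Γ : LatticeSpace E | ∃ γ ∈ Γ.toSubmodule, γ ∈ K n} = 0 := by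
    intro n
    refine measure_eq_zero_of_pointFinite_preimages (ι := unitInterval)
      (LatticeSpace.measurableSet_setOf_meets (hK n))
      (fun t => hμ.measurePreserving_transvection (hf t)) fun Γ => ?_
    -- the points of `Γ` that can be moved into `K n` lie in a compact set
    let C : Set E := (fun p : ℝ × E => p.2 - f p.1 p.2 • b i₀) '' (unitInterval ×ˢ K n)
    have hC : IsCompact C := by
      refine (isCompact_Icc.prod (hK n)).image ?_
      have hc : ∀ j, Continuous (b.coord j) := fun j =>
        (b.coord j).continuous_of_finiteDimensional
      simp only [f, LinearMap.sum_apply, LinearMap.smul_apply]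
      fun_prop
    have hS := (Γ.finite_inter hC.isBounded).subset
      (Set.inter_subset_left (t := {γ : E | γ ≠ 0}))
    refine (finite_setOf_unitInterval hS
      (Q := fun t γ => ∑ j : Fin _, t ^ (j : ℕ) * b.coord j γ = 0) fun γ hγ => ?_).subset ?_
    · refine finite_setOf_sum_pow_eq_zero ?_
      by_contra! h
      exact hγ.2 (b.ext_elem fun j => by simpa using h j)
    · rintro t ⟨x, hx, hxK⟩
      have hsymm : (LinearEquiv.transvection (hf t)).toContinuousLinearEquiv.symm x =
          x - f t x • b i₀ := by
        change (LinearEquiv.transvection (hf t)).symm x = _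
        rw [LinearEquiv.transvection.symm_eq (hf t) (by rw [map_neg, hf, neg_zero])]
        simp [LinearMap.transvection.apply, sub_eq_add_neg]
      rw [LatticeSpace.mem_map_iff, hsymm] at hx
      have hx0 : x ≠ 0 := by
        rintro rfl
        have := hxK.2.2
        simp only [norm_zero, mul_zero] at this
        linarith
      refine ⟨_, ⟨⟨⟨(t, x), ⟨t.2, hxK⟩, rfl⟩, hx⟩, ?_⟩, ?_⟩
      · change x - f t x • b i₀ ≠ 0
        rw [← hsymm]
        simpa using hx0
      · rw [← Finset.add_sum_erase _ _ (Finset.mem_univ i₀)]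
        have h1 : ∑ j ∈ Finset.univ.erase i₀, (t : ℝ) ^ (j : ℕ) * b.coord j (x - f t x • b i₀) =
            f t x := by
          conv_rhs => simp only [f, LinearMap.sum_apply, LinearMap.smul_apply]
          refine Finset.sum_congr rfl fun j hj => ?_
          simp [(Finset.ne_of_mem_erase hj).symm]
        have h2 : b.coord i₀ x = 0 := hxK.1
        rw [h1, map_sub, h2]
        simp [hi₀]
  have hall := ae_all_iff.2 fun n => measure_eq_zero_iff_ae_notMem.1 (hnull n)
  filter_upwards [hall] with Γ hΓ γ hγ hψγ
  by_contra hne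
  obtain ⟨n, hn⟩ := exists_mem_annulus hne
  exact hΓ n ⟨γ, hγ, hψγ, hn⟩

/-- For almost every lattice, no nonzero functional that is integral on the lattice vanishes at a
given nonzero vector. The transvections fixing the hyperplane `x₀ = 0` move `e₀` along the curve
`∑ t ^ j e_j`, at finitely many points of which a given nonzero functional vanishes. -/
theorem IsHaarOnLattices.ae_forall_functional_eq_zero {μ : Measure (LatticeSpace E)}
    (hμ : IsHaarOnLattices μ) {v : E} (hv : v ≠ 0) :
    ∀ᵐ Γ : LatticeSpace E ∂μ, ∀ φ : E →L[ℝ] ℝ,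
      (∀ γ ∈ Γ.toSubmodule, φ γ ∈ Set.range ((↑) : ℤ → ℝ)) → φ v = 0 → φ = 0 := by
  have := hμ.sFinite
  obtain ⟨b, i₀, hi₀, rfl⟩ := exists_basis_apply_eq hv
  let K : ℕ → Set (E →L[ℝ] ℝ) := fun n => {φ | φ (b i₀) = 0 ∧ ‖φ‖ ≤ n ∧ 1 ≤ (n : ℝ) * ‖φ‖}
  have hK : ∀ n, IsCompact (K n) := fun n =>
    isCompact_setOf_eq_zero_annulus (by fun_prop) n
  let w : ℝ → E := fun t => ∑ j ∈ Finset.univ.erase i₀, t ^ (j : ℕ) • b j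
  have hw : ∀ t, b.coord i₀ (-w t) = 0 := by
    intro t
    simp only [w, map_neg, map_sum, map_smul, neg_eq_zero]
    refine Finset.sum_eq_zero fun j hj => ?_
    simp [Finset.ne_of_mem_erase hj]
  have hnull : ∀ n, μ {Γ : LatticeSpace E |
      ∃ φ ∈ K n, ∀ γ ∈ Γ.toSubmodule, φ γ ∈ Set.range ((↑) : ℤ → ℝ)} = 0 := by
    intro n
    refine measure_eq_zero_of_pointFinite_preimages (ι := unitInterval)
      (LatticeSpace.isClosed_setOf_integral (hK n)).measurableSet
      (fun t => hμ.measurePreserving_transvection (hw t)) fun Γ => ?_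
    -- the functionals integral on `Γ` that can be moved into `K n` lie in a compact set
    let c₀ : E →L[ℝ] ℝ := LinearMap.toContinuousLinearMap (b.coord i₀)
    let C : Set (E →L[ℝ] ℝ) :=
      (fun p : ℝ × (E →L[ℝ] ℝ) => p.2 - p.2 (w p.1) • c₀) '' (unitInterval ×ˢ K n)
    have hC : IsCompact C := by
      refine (isCompact_Icc.prod (hK n)).image ?_
      have hc : Continuous w := by fun_prop
      fun_prop
    have hS := (Γ.finite_integral_functionals hC.isBounded).subset
      (Set.inter_subset_left (t := {φ : E →L[ℝ] ℝ | φ ≠ 0}))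
    refine (finite_setOf_unitInterval hS
      (Q := fun t φ => ∑ j : Fin _, t ^ (j : ℕ) * φ (b j) = 0) fun φ hφ => ?_).subset ?_
    · refine finite_setOf_sum_pow_eq_zero ?_
      by_contra! h
      exact hφ.2 (ContinuousLinearMap.coe_injective (b.ext fun j => by simpa using h j))
    · rintro t ⟨φ, hφK, hφ⟩
      have hg : ∀ x, (φ - φ (w t) • c₀) x = φ (LinearEquiv.transvection (hw t) x) := by
        intro x
        simp [LinearMap.transvection.apply, c₀, sub_eq_add_neg, mul_comm]
      have hφ0 : φ ≠ 0 := by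
        rintro rfl
        have := hφK.2.2
        simp only [norm_zero, mul_zero] at this
        linarith
      refine ⟨_, ⟨⟨⟨(t, φ), ⟨t.2, hφK⟩, rfl⟩, fun γ hγ => ?_⟩, fun h0 => ?_⟩, ?_⟩
      · change (φ - φ (w t) • c₀) γ ∈ _
        rw [hg]
        refine hφ _ ((LatticeSpace.mem_map_iff _ _ _).2 ?_)
        rwa [show LinearEquiv.transvection (hw t) γ =
          (LinearEquiv.transvection (hw t)).toContinuousLinearEquiv γ from rfl,
          ContinuousLinearEquiv.symm_apply_apply]
      · refine hφ0 (ContinuousLinearMap.ext fun x => ?_)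
        have := hg ((LinearEquiv.transvection (hw t)).symm x)
        rw [LinearEquiv.apply_symm_apply] at this
        rw [← this]
        exact congrArg (fun χ : E →L[ℝ] ℝ => χ ((LinearEquiv.transvection (hw t)).symm x)) h0
      · change ∑ j : Fin _, (t : ℝ) ^ (j : ℕ) * (φ - φ (w t) • c₀) (b j) = 0
        rw [← Finset.add_sum_erase _ _ (Finset.mem_univ i₀)]
        have h1 : ∑ j ∈ Finset.univ.erase i₀, (t : ℝ) ^ (j : ℕ) * (φ - φ (w t) • c₀) (b j) =
            φ (w t) := by
          conv_rhs => simp only [w, map_sum, map_smul]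
          refine Finset.sum_congr rfl fun j hj => ?_
          simp [c₀, Finset.ne_of_mem_erase hj]
        have h2 : φ (b i₀) = 0 := hφK.1
        rw [h1]
        simp [hi₀, c₀, h2]
  have hall := ae_all_iff.2 fun n => measure_eq_zero_iff_ae_notMem.1 (hnull n)
  filter_upwards [hall] with Γ hΓ φ hφ hφv
  by_contra hne
  obtain ⟨n, hn⟩ := exists_mem_annulus hne
  exact hΓ n ⟨φ, ⟨hφv, hn⟩, hφ⟩

end Transvections

/-! ### Dense subgroups of Euclidean spaces -/

section DenseSubgroups

variable {V : Type*} [NormedAddCommGroup V] [InnerProductSpace ℝ V] [FiniteDimensional ℝ V]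

/-- The union of the lines through the origin contained in a subgroup, which is the largest linear
subspace contained in it. -/
def AddSubgroup.lines (G : AddSubgroup V) : Submodule ℝ V where
  carrier := {v | ∀ t : ℝ, t • v ∈ G}
  add_mem' ha hb t := by rw [smul_add]; exact G.add_mem (ha t) (hb t)
  zero_mem' t := by rw [smul_zero]; exact G.zero_mem
  smul_mem' c v hv t := by rw [smul_smul]; exact hv (t * c)

/-- A closed subgroup has no small nonzero points orthogonal to all the lines it contains: the
directions of ever smaller such points would accumulate at the direction of one more line. -/
theorem AddSubgroup.exists_pos_forall_norm_lt {G : AddSubgroup V} (hG : IsClosed (G : Set V)) :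
    ∃ ε > 0, ∀ g ∈ G, g ∈ (G.lines)ᗮ → ‖g‖ < ε → g = 0 := by
  by_contra! hcon
  have hex : ∀ n : ℕ, ∃ g ∈ G, g ∈ (G.lines)ᗮ ∧ ‖g‖ < 1 / ((n : ℝ) + 1) ∧ g ≠ 0 := fun n => by
    obtain ⟨g, h1, h2, h3, h4⟩ := hcon (1 / ((n : ℝ) + 1)) (by positivity)
    exact ⟨g, h1, h2, h3, h4⟩
  choose g hgG hgL hgn hg0 using hex
  have hpos : ∀ n, 0 < ‖g n‖ := fun n => norm_pos_iff.2 (hg0 n)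
  have hlim : Tendsto (fun n => ‖g n‖) atTop (𝓝 0) :=
    squeeze_zero (fun n => norm_nonneg _) (fun n => (hgn n).le)
      tendsto_one_div_add_atTop_nhds_zero_nat
  have hsph : ∀ n, ‖g n‖⁻¹ • g n ∈ Metric.sphere (0 : V) 1 := fun n => by
    simp [norm_smul, (hpos n).ne']
  obtain ⟨u, hu, k, hk, hku⟩ := (isCompact_sphere (0 : V) 1).tendsto_subseq hsph
  have hu1 : ‖u‖ = 1 := by simpa using hu
  -- the integer multiples `⌊t / ‖g‖⌋ • g` of the small points `g` converge to `t • u`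
  have hline : u ∈ G.lines := by
    intro t
    have hfrac : Tendsto (fun n => (⌊t / ‖g (k n)‖⌋ : ℝ) * ‖g (k n)‖) atTop (𝓝 t) := by
      have hl := hlim.comp hk.tendsto_atTop
      refine tendsto_of_tendsto_of_tendsto_of_le_of_le
        (g := fun n => t - ‖g (k n)‖) (h := fun _ => t) ?_ tendsto_const_nhds ?_ ?_
      · simpa using tendsto_const_nhds.sub hl
      · intro n
        have h1 := Int.lt_floor_add_one (t / ‖g (k n)‖)
        rw [div_lt_iff₀ (hpos _)] at h1
        simp only
        linarith
      · intro n
        exact (le_div_iff₀ (hpos _)).1 (Int.floor_le (t / ‖g (k n)‖))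
    have hmul : Tendsto (fun n => ⌊t / ‖g (k n)‖⌋ • g (k n)) atTop (𝓝 (t • u)) := by
      refine (hfrac.smul hku).congr fun n => ?_
      simp only [Function.comp_apply]
      rw [smul_smul, mul_assoc, mul_inv_cancel₀ (hpos _).ne', mul_one, Int.cast_smul_eq_zsmul]
    exact hG.mem_of_tendsto hmul (Eventually.of_forall fun n => G.zsmul_mem (hgG _) _)
  have horth : u ∈ (G.lines)ᗮ :=
    (Submodule.isClosed_orthogonal G.lines).mem_of_tendsto hku
      (Eventually.of_forall fun n => Submodule.smul_mem _ _ (hgL _))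
  have : u = 0 := by
    rw [← inner_self_eq_zero (𝕜 := ℝ)]
    exact horth u hline
  rw [this, norm_zero] at hu1
  exact zero_ne_one hu1

/-- A closed proper subgroup spanning `V` is annihilated modulo `ℤ` by a nonzero functional: modulo
the lines that it contains, the subgroup is a lattice, and a coordinate functional of this lattice
will do. -/
theorem AddSubgroup.exists_functional_of_isClosed {G : AddSubgroup V} (hG : IsClosed (G : Set V))
    (hspan : Submodule.span ℝ (G : Set V) = ⊤) (hne : G ≠ ⊤) :
    ∃ φ : V →ₗ[ℝ] ℝ, φ ≠ 0 ∧ ∀ g ∈ G, φ g ∈ Set.range ((↑) : ℤ → ℝ) := by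
  set U : Submodule ℝ V := (G.lines)ᗮ
  let L : Submodule ℤ U := (AddSubgroup.toIntSubmodule G).comap (U.subtype.restrictScalars ℤ)
  have hLmem : ∀ x : U, x ∈ L ↔ (x : V) ∈ G := fun x => Iff.rfl
  have hlinesG : ∀ v ∈ G.lines, v ∈ G := fun v hv => by simpa using hv 1
  let p : V →ₗ[ℝ] U := (U.orthogonalProjectionOnto : V →L[ℝ] U)
  have hp : ∀ g ∈ G, p g ∈ L := by
    intro g hg
    rw [hLmem]
    have h1 : g - (p g : V) ∈ G.lines := by
      have : g - (p g : V) ∈ Uᗮ := U.sub_starProjection_mem_orthogonal g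
      rwa [Submodule.orthogonal_orthogonal] at this
    simpa using G.sub_mem hg (hlinesG _ h1)
  have hdisc : DiscreteTopology L := by
    obtain ⟨ε, hε, h⟩ := AddSubgroup.exists_pos_forall_norm_lt hG
    refine discreteTopology_of_isOpen_singleton_zero ?_
    have : ({0} : Set L) = Metric.ball 0 ε := by
      ext x
      rw [Set.mem_singleton_iff, mem_ball_zero_iff]
      refine ⟨fun hx => by simpa [hx] using hε, fun hx => ?_⟩
      exact Subtype.ext (Subtype.ext (h _ x.2 x.1.2 hx))
    rw [this]
    exact Metric.isOpen_ball
  have hlat : IsZLattice ℝ L := by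
    refine ⟨top_unique ?_⟩
    have h1 : (⊤ : Submodule ℝ U) = Submodule.map p (Submodule.span ℝ (G : Set V)) := by
      rw [hspan, Submodule.map_top, eq_comm, LinearMap.range_eq_top]
      intro x
      exact ⟨x, U.orthogonalProjectionOnto_mem_subspace_eq_self x⟩
    rw [h1, Submodule.map_span]
    refine Submodule.span_mono ?_
    rintro _ ⟨g, hg, rfl⟩
    exact hp g hg
  have hU : Nontrivial U := by
    by_contra hcon
    rw [Submodule.nontrivial_iff_ne_bot, not_not] at hcon
    refine hne (top_unique fun v _ => hlinesG v ?_)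
    have : G.lines = ⊤ := by
      rw [← Submodule.orthogonal_orthogonal G.lines]
      change Uᗮ = ⊤
      rw [hcon, Submodule.bot_orthogonal_eq_top]
    rw [this]
    trivial
  let b₀ := Module.finBasis ℤ L
  let b := b₀.ofZLatticeBasis ℝ L
  have hpos : 0 < finrank ℤ L := by
    rw [ZLattice.rank ℝ L]
    exact finrank_pos
  let i : Fin (finrank ℤ L) := ⟨0, hpos⟩
  refine ⟨(b.coord i).comp p, ?_, fun g hg => ?_⟩
  · intro h0
    have h1 : p (b i : V) = b i := U.orthogonalProjectionOnto_mem_subspace_eq_self (b i)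
    have h2 := LinearMap.congr_fun h0 (b i : V)
    rw [LinearMap.comp_apply, h1] at h2
    simp at h2
  · refine ⟨b₀.repr ⟨p g, hp g hg⟩ i, ?_⟩
    have := b₀.ofZLatticeBasis_repr_apply ℝ L ⟨p g, hp g hg⟩ i
    simpa using this.symm

/-- Kronecker's criterion: a spanning subgroup is dense unless some nonzero functional takes integer
values on it. -/
theorem AddSubgroup.dense_of_forall_functional {G : AddSubgroup V}
    (hspan : Submodule.span ℝ (G : Set V) = ⊤)
    (h : ∀ φ : V →ₗ[ℝ] ℝ, (∀ g ∈ G, φ g ∈ Set.range ((↑) : ℤ → ℝ)) → φ = 0) :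
    Dense (G : Set V) := by
  by_contra hcon
  obtain ⟨φ, hφ, hint⟩ := AddSubgroup.exists_functional_of_isClosed
    (G := G.topologicalClosure) G.isClosed_topologicalClosure
    (top_unique (hspan ▸ Submodule.span_mono G.le_topologicalClosure)) (fun htop => hcon (by
      rw [dense_iff_closure_eq, ← AddSubgroup.topologicalClosure_coe, htop, AddSubgroup.coe_top]))
  exact hφ (h φ fun g hg => hint g (G.le_topologicalClosure hg))

end DenseSubgroups

/-! ### Counting half-space patterns -/

section HalfSpacePatterns

/-- The sets of indices of the half-spaces containing a given point shatter no set of more than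
`dim V` indices: a linear dependence among the normals forbids one of two opposite patterns. -/
theorem card_le_finrank_of_shatters {ι V : Type*} [Fintype ι] [DecidableEq ι] [AddCommGroup V]
    [Module ℝ V] [FiniteDimensional ℝ V] (f : ι → Dual ℝ V) (c : ι → ℝ)
    {𝒜 : Finset (Finset ι)} (h𝒜 : ∀ A ∈ 𝒜, ∃ y, ∀ i, i ∈ A ↔ c i ≤ f i y) {s : Finset ι}
    (hs : 𝒜.Shatters s) : s.card ≤ finrank ℝ V := by
  by_contra! hlt
  have hdep : ¬ LinearIndependent ℝ (fun i : s => f i) := fun hli => by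
    have := hli.fintype_card_le_finrank
    rw [Subspace.dual_finrank_eq, Fintype.card_coe] at this
    omega
  obtain ⟨g, hg, i₀, hi₀⟩ := Fintype.not_linearIndependent_iff.1 hdep
  have hconst : ∀ y, ∑ i : s, g i * (f i y - c i) = -∑ i : s, g i * c i := by
    intro y
    have := LinearMap.congr_fun hg y
    simp only [LinearMap.sum_apply, LinearMap.smul_apply, smul_eq_mul, LinearMap.zero_apply] at this
    simp_rw [mul_sub, Finset.sum_sub_distrib, this, zero_sub]
  have hpat : ∀ p : s → Prop, ∃ y, ∀ i : s, p i ↔ c i ≤ f i y := by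
    intro p
    classical
    obtain ⟨A, hA, hsA⟩ := hs (t := (Finset.univ.filter p).map (Function.Embedding.subtype _))
      (fun i hi => by
        obtain ⟨j, -, rfl⟩ := Finset.mem_map.1 hi
        exact j.2)
    obtain ⟨y, hy⟩ := h𝒜 A hA
    refine ⟨y, fun i => ?_⟩
    rw [← hy]
    have := Finset.ext_iff.1 hsA i
    simpa using this.symm
  obtain ⟨y₁, h₁⟩ := hpat fun i => 0 < g i
  obtain ⟨y₂, h₂⟩ := hpat fun i => g i < 0
  have e₁ : ∀ i : s, 0 ≤ g i * (f i y₁ - c i) := by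
    intro i
    rcases lt_or_ge 0 (g i) with h | h
    · exact mul_nonneg h.le (sub_nonneg.2 ((h₁ i).1 h))
    · have : f i y₁ < c i := not_le.1 fun h' => h.not_gt ((h₁ i).2 h')
      exact mul_nonneg_of_nonpos_of_nonpos h (sub_neg.2 this).le
  have e₂ : ∀ i : s, g i * (f i y₂ - c i) ≤ 0 := by
    intro i
    rcases lt_or_ge (g i) 0 with h | h
    · exact mul_nonpos_of_nonpos_of_nonneg h.le (sub_nonneg.2 ((h₂ i).1 h))
    · have : f i y₂ < c i := not_le.1 fun h' => h.not_gt ((h₂ i).2 h')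
      exact mul_nonpos_of_nonneg_of_nonpos h (sub_neg.2 this).le
  have s₁ : 0 ≤ ∑ i : s, g i * (f i y₁ - c i) := Finset.sum_nonneg fun i _ => e₁ i
  have s₂ : ∑ i : s, g i * (f i y₂ - c i) ≤ 0 := Finset.sum_nonpos fun i _ => e₂ i
  have z₁ := (Finset.sum_eq_zero_iff_of_nonneg fun i _ => e₁ i).1
    (le_antisymm (by rw [hconst, ← hconst y₂]; exact s₂) s₁) i₀ (Finset.mem_univ _)
  have z₂ := (Finset.sum_eq_zero_iff_of_nonpos fun i _ => e₂ i).1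
    (le_antisymm s₂ (by rw [hconst, ← hconst y₁]; exact s₁)) i₀ (Finset.mem_univ _)
  rw [mul_eq_zero, or_iff_right hi₀, sub_eq_zero] at z₁ z₂
  rcases lt_or_gt_of_ne hi₀ with h | h
  · exact h.not_gt ((h₁ i₀).2 z₁.ge)
  · exact h.not_gt ((h₂ i₀).2 z₂.ge)

/-- The number of patterns cut out by `M` half-spaces in an `n`-dimensional space is at most
`(M + 1) ^ n`, by the Sauer-Shelah lemma. -/
theorem ncard_halfSpace_patterns_le {ι V : Type*} [Fintype ι] [AddCommGroup V]
    [Module ℝ V] [FiniteDimensional ℝ V] (f : ι → Dual ℝ V) (c : ι → ℝ) :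
    (Set.range fun y : V => {i | c i ≤ f i y}).ncard ≤ (Fintype.card ι + 1) ^ finrank ℝ V := by
  classical
  set 𝒜 : Finset (Finset ι) :=
    (Set.range fun y : V => Finset.univ.filter fun i => c i ≤ f i y).toFinset
  have h𝒜 : ∀ A ∈ 𝒜, ∃ y, ∀ i, i ∈ A ↔ c i ≤ f i y := by
    intro A hA
    obtain ⟨y, rfl⟩ := Set.mem_toFinset.1 hA
    exact ⟨y, fun i => by simp⟩
  have hvc : 𝒜.vcDim ≤ finrank ℝ V := Finset.sup_le fun s hs =>
    card_le_finrank_of_shatters f c h𝒜 (Finset.mem_shatterer.1 hs)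
  have himg : (Set.range fun y : V => {i | c i ≤ f i y}) =
      (fun A : Finset ι => (A : Set ι)) '' (𝒜 : Set (Finset ι)) := by
    ext A
    simp [𝒜, Set.ext_iff]
  calc (Set.range fun y : V => {i | c i ≤ f i y}).ncard
      ≤ 𝒜.card := by
        rw [himg, ← Set.ncard_coe_finset]
        exact Set.ncard_image_le 𝒜.finite_toSet
    _ ≤ 𝒜.shatterer.card := 𝒜.card_le_card_shatterer
    _ ≤ ∑ k ∈ Finset.Iic 𝒜.vcDim, (Fintype.card ι).choose k := Finset.card_shatterer_le_sum_vcDim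
    _ ≤ ∑ k ∈ Finset.Iic (finrank ℝ V), (Fintype.card ι).choose k :=
        Finset.sum_le_sum_of_subset (Finset.Iic_subset_Iic.2 hvc)
    _ ≤ ∑ k ∈ Finset.range (finrank ℝ V + 1),
          Fintype.card ι ^ k * 1 ^ (finrank ℝ V - k) * (finrank ℝ V).choose k := by
        rw [show Finset.Iic (finrank ℝ V) = Finset.range (finrank ℝ V + 1) from
          (Nat.range_succ_eq_Iic _).symm]
        refine Finset.sum_le_sum fun k hk => ?_
        rw [one_pow, mul_one]
        refine (Nat.choose_le_pow _ _).trans (Nat.le_mul_of_pos_right _ ?_)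
        exact Nat.choose_pos (by simpa [Nat.lt_succ_iff] using hk)
    _ = (Fintype.card ι + 1) ^ finrank ℝ V := (add_pow _ _ _).symm

end HalfSpacePatterns

/-! ### Polytopal windows near their facets -/

section PolytopalGeometry

variable {U : Type*} [NormedAddCommGroup U] [InnerProductSpace ℝ U]

theorem mem_halfSpace_iff {η α x : U} : x ∈ halfSpace η α ↔ inner ℝ η α ≤ inner ℝ η x := by
  rw [halfSpace, Set.mem_ofPred_eq, real_inner_comm, inner_sub_right, sub_nonneg]

theorem mem_affineHyperplane_iff {η α x : U} :
    x ∈ affineHyperplane η α ↔ inner ℝ η x = inner ℝ η α := by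
  rw [affineHyperplane, Set.mem_ofPred_eq, real_inner_comm, inner_sub_right, sub_eq_zero]

theorem halfSpace_eq_preimage (η α : U) :
    halfSpace η α = innerSL ℝ η ⁻¹' Set.Ici (inner ℝ η α) := by
  ext x
  simp [mem_halfSpace_iff]

theorem surjective_innerSL {η : U} (hη : η ≠ 0) : Function.Surjective (innerSL ℝ η) := by
  intro t
  refine ⟨(t / inner ℝ η η) • η, ?_⟩
  have : inner ℝ η η ≠ 0 := inner_self_ne_zero.2 hη
  rw [innerSL_apply_apply, real_inner_smul_right, div_mul_cancel₀ _ this]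

theorem interior_halfSpace_eq [CompleteSpace U] {η : U} (hη : η ≠ 0) (α : U) :
    interior (halfSpace η α) = {x | inner ℝ η α < inner ℝ η x} := by
  rw [halfSpace_eq_preimage, ContinuousLinearMap.interior_preimage _ (surjective_innerSL hη),
    interior_Ici]
  ext x
  simp

/-- A bounding hyperplane is determined by its half-space, as the frontier. -/
theorem frontier_halfSpace_eq [CompleteSpace U] {η : U} (hη : η ≠ 0) (α : U) :
    frontier (halfSpace η α) = affineHyperplane η α := by
  rw [halfSpace_eq_preimage, ContinuousLinearMap.frontier_preimage _ (surjective_innerSL hη),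
    frontier_Ici]
  ext x
  simp [mem_affineHyperplane_iff]

/-- On the bounding hyperplane of each half-space there is a point around which the window agrees
with that half-space. It is found where a segment from an interior point of the window to a point
outside only this half-space, given by irredundance, crosses the hyperplane. -/
theorem IsPolytopalWindow.exists_facet_point [CompleteSpace U] {W : Set U} {𝓢 : Set (Set U)}
    (hW : IsPolytopalWindow W 𝓢) {η α : U} (hη : η ≠ 0) (hS : halfSpace η α ∈ 𝓢) :
    ∃ p : U, inner ℝ η p = inner ℝ η α ∧ ∀ᶠ z in 𝓝 p, z ∈ W ↔ z ∈ halfSpace η α := by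
  obtain ⟨w, hw⟩ := hW.interior_nonempty
  have hwS : ∀ S ∈ 𝓢, w ∈ interior S := fun S hS' =>
    interior_mono (hW.sInter_eq ▸ Set.sInter_subset_of_mem hS') hw
  obtain ⟨x, hx, hxS⟩ : ∃ x ∈ ⋂₀ (𝓢 \ {halfSpace η α}), x ∉ halfSpace η α := by
    by_contra! hcon
    refine hW.irredundant _ hS (subset_antisymm ?_ ?_)
    · rw [← hW.sInter_eq]
      intro x hx S hS'
      by_cases h : S = halfSpace η α
      · exact h ▸ hcon x hx
      · exact hx S ⟨hS', h⟩
    · rw [← hW.sInter_eq]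
      exact Set.sInter_subset_sInter Set.sdiff_subset
  have hw1 : inner ℝ η α < inner ℝ η w := by
    have := hwS _ hS
    rwa [interior_halfSpace_eq hη] at this
  have hx1 : inner ℝ η x < inner ℝ η α := by
    rwa [mem_halfSpace_iff, not_le] at hxS
  set a : ℝ := inner ℝ η w - inner ℝ η α
  set b : ℝ := inner ℝ η α - inner ℝ η x
  have ha : 0 < a := sub_pos.2 hw1
  have hb : 0 < b := sub_pos.2 hx1
  set p : U := (b / (a + b)) • w + (a / (a + b)) • x
  have hab : b / (a + b) + a / (a + b) = 1 := by field_simp; ring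
  have hp : inner ℝ η p = inner ℝ η α := by
    simp only [p, inner_add_right, real_inner_smul_right]
    field_simp
    simp only [a, b]
    ring
  have hpint : ∀ S ∈ 𝓢 \ {halfSpace η α}, p ∈ interior S := by
    intro S hS'
    obtain ⟨η', α', hη', rfl⟩ := hW.isHalfSpace S hS'.1
    have h1 := hwS _ hS'.1
    have h2 := hx _ hS'
    rw [interior_halfSpace_eq hη', Set.mem_ofPred_eq] at h1 ⊢
    rw [mem_halfSpace_iff] at h2
    simp only [p, inner_add_right, real_inner_smul_right]
    have h3 := mul_lt_mul_of_pos_left h1 (div_pos hb (add_pos ha hb))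
    have h4 := mul_le_mul_of_nonneg_left h2 (div_pos ha (add_pos ha hb)).le
    have h5 : inner ℝ η' α' = b / (a + b) * inner ℝ η' α' + a / (a + b) * inner ℝ η' α' := by
      rw [← add_mul, hab, one_mul]
    linarith
  refine ⟨p, hp, ?_⟩
  have hev : ∀ᶠ z in 𝓝 p, ∀ S ∈ 𝓢 \ {halfSpace η α}, z ∈ S := by
    rw [(hW.finite.subset Set.sdiff_subset).eventually_all]
    exact fun S hS' => mem_interior_iff_mem_nhds.1 (hpint S hS')
  filter_upwards [hev] with z hz
  rw [← hW.sInter_eq]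
  refine ⟨fun h => h _ hS, fun h S hS' => ?_⟩
  by_cases hSS : S = halfSpace η α
  · exact hSS ▸ h
  · exact hz S ⟨hS', hSS⟩

/-- A vector orthogonal to all facet normals of a window is zero, as otherwise the window would
contain a line. -/
theorem IsPolytopalWindow.eq_zero_of_forall_inner {W : Set U} {𝓢 : Set (Set U)}
    (hW : IsPolytopalWindow W 𝓢) {v : U}
    (hv : ∀ η α : U, halfSpace η α ∈ 𝓢 → inner ℝ η v = 0) : v = 0 := by
  obtain ⟨w, hw⟩ := hW.interior_nonempty
  have hwW := interior_subset hw
  have hline : ∀ t : ℝ, w + t • v ∈ W := by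
    intro t
    rw [← hW.sInter_eq] at hwW ⊢
    intro S hS
    obtain ⟨η, α, hη, rfl⟩ := hW.isHalfSpace S hS
    rw [mem_halfSpace_iff, inner_add_right, real_inner_smul_right, hv η α hS, mul_zero, add_zero]
    exact mem_halfSpace_iff.1 (hwW _ hS)
  obtain ⟨C, hC⟩ := hW.isCompact.isBounded.exists_norm_le
  by_contra hne
  have hpos : 0 < ‖v‖ := norm_pos_iff.2 hne
  have h1 := hC _ (hline ((C + ‖w‖ + 1) / ‖v‖))
  have h2 : ‖((C + ‖w‖ + 1) / ‖v‖) • v‖ = C + ‖w‖ + 1 := by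
    have : 0 ≤ C := (norm_nonneg w).trans (hC w hwW)
    rw [norm_smul, Real.norm_of_nonneg (by positivity), div_mul_cancel₀ _ hpos.ne']
  have h3 := norm_sub_le (w + ((C + ‖w‖ + 1) / ‖v‖) • v) w
  rw [add_sub_cancel_left, h2] at h3
  linarith

/-- Some facet normals of a window form a coordinate system of the internal space. -/
theorem IsPolytopalWindow.exists_coordinates [FiniteDimensional ℝ U] {W : Set U} {𝓢 : Set (Set U)}
    (hW : IsPolytopalWindow W 𝓢) :
    ∃ (η α : Fin (finrank ℝ U) → U) (Φ : U ≃L[ℝ] (Fin (finrank ℝ U) → ℝ)),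
      (∀ i, η i ≠ 0 ∧ halfSpace (η i) (α i) ∈ 𝓢) ∧ ∀ x i, Φ x i = inner ℝ (η i) x := by
  set T : Set U := {η | η ≠ 0 ∧ ∃ α, halfSpace η α ∈ 𝓢}
  have hspan : Submodule.span ℝ T = ⊤ := by
    rw [← Submodule.orthogonal_eq_bot_iff, Submodule.eq_bot_iff]
    intro v hv
    refine hW.eq_zero_of_forall_inner fun η α hS => ?_
    rcases eq_or_ne η 0 with rfl | hη
    · exact inner_zero_left _
    · exact hv η (Submodule.subset_span ⟨hη, α, hS⟩)
  obtain ⟨B, hBT, hBspan, hBli⟩ := exists_linearIndependent ℝ T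
  rw [hspan] at hBspan
  let b₀ : Basis B ℝ U := Basis.mk hBli (by simp [hBspan])
  have hfin : Finite B := Module.Finite.finite_basis b₀
  have := Fintype.ofFinite B
  let b : Basis (Fin (finrank ℝ U)) ℝ U :=
    b₀.reindex (Fintype.equivFinOfCardEq (finrank_eq_card_basis b₀).symm)
  have hb : ∀ i, b i ∈ T := fun i => hBT (by simp [b, b₀])
  choose hne α hα using hb
  let Φ₀ : U →ₗ[ℝ] (Fin (finrank ℝ U) → ℝ) := LinearMap.pi fun i => (innerSL ℝ (b i) : U →ₗ[ℝ] ℝ)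
  have hinj : Function.Injective Φ₀ := by
    rw [injective_iff_map_eq_zero]
    intro v hv
    have h : (⊤ : Submodule ℝ U) ≤ (Submodule.span ℝ {v})ᗮ := by
      rw [← b.span_eq, Submodule.span_le]
      rintro _ ⟨i, rfl⟩
      rw [SetLike.mem_coe, Submodule.mem_orthogonal_singleton_iff_inner_left]
      simpa [Φ₀] using congrFun hv i
    exact inner_self_eq_zero.1
      (Submodule.mem_orthogonal_singleton_iff_inner_left.1 (h (Submodule.mem_top (x := v))))
  let Φ := (LinearEquiv.ofInjectiveOfFinrankEq Φ₀ hinj (by simp)).toContinuousLinearEquiv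
  exact ⟨b, α, Φ, fun i => ⟨hne i, hα i⟩, fun x i => rfl⟩

end PolytopalGeometry

/-! ### Counting lattice points in cylinders -/

section LatticeCounting

variable {E : Type*} [NormedAddCommGroup E] [InnerProductSpace ℝ E]
  {P N : Submodule ℝ E}

theorem projPhys_add_projInt (hPN : IsCompl P N) (x : E) :
    (projPhys hPN x : E) + (projInt hPN x : E) = x :=
  Submodule.projection_add_projection_eq_self hPN x

theorem norm_le_norm_projPhys_add_norm_projInt (hPN : IsCompl P N) (x : E) :
    ‖x‖ ≤ ‖projPhys hPN x‖ + ‖projInt hPN x‖ := by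
  conv_lhs => rw [← projPhys_add_projInt hPN x]
  exact norm_add_le _ _

variable [FiniteDimensional ℝ E]

/-- The lattice points in a bounded cylinder, which label the translated windows that decide the
`r`-patches. -/
def latticeCylinder (hPN : IsCompl P N) (Γ : LatticeSpace E) (K : Set N) (r : ℝ) : Set E :=
  {γ | γ ∈ Γ.toSubmodule ∧ ‖projPhys hPN γ‖ ≤ r ∧ projInt hPN γ ∈ K}

theorem finite_latticeCylinder (hPN : IsCompl P N) (Γ : LatticeSpace E) {K : Set N}
    (hK : Bornology.IsBounded K) (r : ℝ) : (latticeCylinder hPN Γ K r).Finite := by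
  obtain ⟨C, hC⟩ := hK.exists_norm_le
  refine (Γ.finite_inter (Metric.isBounded_closedBall (x := (0 : E)) (r := r + C))).subset ?_
  rintro γ ⟨h1, h2, h3⟩
  refine ⟨?_, h1⟩
  rw [mem_closedBall_zero_iff]
  exact (norm_le_norm_projPhys_add_norm_projInt hPN γ).trans (add_le_add h2 (hC _ h3))

/-- A cylinder of radius `r` contains `O(r ^ d)` lattice points: it is covered by `O(r ^ d)` boxes,
and the points in one box differ from each other by elements of a fixed finite set. -/
theorem exists_ncard_latticeCylinder_le (hPN : IsCompl P N) (Γ : LatticeSpace E) {K : Set N}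
    (hK : Bornology.IsBounded K) :
    ∃ C : ℝ, 0 ≤ C ∧ ∀ r : ℝ, 1 ≤ r →
      ((latticeCylinder hPN Γ K r).ncard : ℝ) ≤ C * r ^ finrank ℝ P := by
  classical
  let e : P ≃L[ℝ] (Fin (finrank ℝ P) → ℝ) := ContinuousLinearEquiv.ofFinrankEq (by simp)
  set A : ℝ := ‖(e : P →L[ℝ] (Fin (finrank ℝ P) → ℝ))‖
  set A' : ℝ := ‖(e.symm : (Fin (finrank ℝ P) → ℝ) →L[ℝ] P)‖
  have hA : 0 ≤ A := norm_nonneg (e : P →L[ℝ] (Fin (finrank ℝ P) → ℝ))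
  have hF₀ := finite_latticeCylinder hPN Γ (hK.sub hK) A'
  refine ⟨(latticeCylinder hPN Γ (K - K) A').ncard * (2 * A + 3) ^ finrank ℝ P, by positivity,
    fun r hr => ?_⟩
  have hF := finite_latticeCylinder hPN Γ hK r
  set z : E → (Fin (finrank ℝ P) → ℤ) := fun γ i => ⌊e (projPhys hPN γ) i⌋
  have hfib : ∀ w ∈ hF.toFinset.image z,
      (hF.toFinset.filter (fun γ => z γ = w)).card ≤ (latticeCylinder hPN Γ (K - K) A').ncard := by
    intro w hw
    obtain ⟨γ₀, hγ₀, rfl⟩ := Finset.mem_image.1 hw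
    rw [Set.Finite.mem_toFinset] at hγ₀
    rw [Set.ncard_eq_toFinset_card _ hF₀]
    refine Finset.card_le_card_of_injOn (fun γ => γ - γ₀) ?_ (sub_left_injective.injOn)
    intro γ hγ
    simp only [Finset.coe_filter, Set.Finite.mem_toFinset, Set.mem_ofPred_eq] at hγ
    obtain ⟨⟨h1, h2, h3⟩, h4⟩ := hγ
    simp only [Set.Finite.coe_toFinset]
    refine ⟨Γ.toSubmodule.sub_mem h1 hγ₀.1, ?_, ?_⟩
    · have h5 : ‖e (projPhys hPN (γ - γ₀))‖ ≤ 1 := by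
        rw [pi_norm_le_iff_of_nonneg zero_le_one]
        intro i
        rw [map_sub, map_sub, Pi.sub_apply, Real.norm_eq_abs]
        exact (Int.abs_sub_lt_one_of_floor_eq_floor (congrFun h4 i)).le
      calc ‖projPhys hPN (γ - γ₀)‖ = ‖e.symm (e (projPhys hPN (γ - γ₀)))‖ := by simp
        _ ≤ A' * ‖e (projPhys hPN (γ - γ₀))‖ :=
            (e.symm : (Fin (finrank ℝ P) → ℝ) →L[ℝ] P).le_opNorm _
        _ ≤ A' * 1 := mul_le_mul_of_nonneg_left h5 (ContinuousLinearMap.opNorm_nonneg _)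
        _ = A' := mul_one _
    · rw [map_sub]
      exact Set.sub_mem_sub h3 hγ₀.2.2
  have himg : ((hF.toFinset.image z).card : ℝ) ≤ ((2 * A + 3) * r) ^ finrank ℝ P := by
    have hsub : hF.toFinset.image z ⊆
        Fintype.piFinset fun _ : Fin (finrank ℝ P) => Finset.Icc (-⌈A * r⌉) ⌈A * r⌉ := by
      intro w hw
      obtain ⟨γ, hγ, rfl⟩ := Finset.mem_image.1 hw
      rw [Set.Finite.mem_toFinset] at hγ
      rw [Fintype.mem_piFinset]
      intro i
      have h1 : |e (projPhys hPN γ) i| ≤ A * r := by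
        refine (norm_le_pi_norm (e (projPhys hPN γ)) i).trans ?_
        refine ((e : P →L[ℝ] (Fin (finrank ℝ P) → ℝ)).le_opNorm _).trans ?_
        exact mul_le_mul_of_nonneg_left hγ.2.1 hA
      obtain ⟨h2, h3⟩ := abs_le.1 h1
      rw [Finset.mem_Icc]
      constructor
      · refine Int.le_floor.2 ?_
        push_cast
        linarith [Int.le_ceil (A * r)]
      · exact_mod_cast (Int.floor_le _).trans (h3.trans (Int.le_ceil (A * r)))
    have hc : 0 ≤ ⌈A * r⌉ := Int.ceil_nonneg (by positivity)
    have hcard := Finset.card_le_card hsub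
    rw [Fintype.card_piFinset_const, Int.card_Icc] at hcard
    have h4 : (((⌈A * r⌉ + 1 - -⌈A * r⌉).toNat : ℕ) : ℝ) = 2 * ⌈A * r⌉ + 1 := by
      rw [← Int.cast_natCast, Int.toNat_of_nonneg (by omega)]
      push_cast
      ring
    calc ((hF.toFinset.image z).card : ℝ)
        ≤ (((⌈A * r⌉ + 1 - -⌈A * r⌉).toNat : ℕ) : ℝ) ^ finrank ℝ P := by exact_mod_cast hcard
      _ ≤ ((2 * A + 3) * r) ^ finrank ℝ P := by
          rw [h4]
          have := Int.ceil_lt_add_one (A * r)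
          have h5 : (0 : ℝ) ≤ ⌈A * r⌉ := by exact_mod_cast hc
          exact pow_le_pow_left₀ (by positivity) (by nlinarith) _
  rw [Set.ncard_eq_toFinset_card _ hF]
  have hmul := Finset.card_le_mul_card_image hF.toFinset _ hfib
  calc (hF.toFinset.card : ℝ)
      ≤ (latticeCylinder hPN Γ (K - K) A').ncard * ((hF.toFinset.image z).card : ℝ) := by
        exact_mod_cast hmul
    _ ≤ (latticeCylinder hPN Γ (K - K) A').ncard * ((2 * A + 3) * r) ^ finrank ℝ P := by gcongr
    _ = _ := by rw [mul_pow, mul_assoc]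

/-- If the lattice projects densely to the internal space, then the lattice points that project into
a given open set there are relatively dense in the physical space. -/
theorem exists_relativelyDense (hPN : IsCompl P N) (Γ : LatticeSpace E)
    (hdense : Dense (projInt hPN '' (Γ.toSubmodule : Set E))) {U : Set N} (hU : IsOpen U)
    (hne : U.Nonempty) :
    ∃ D : ℝ, 0 ≤ D ∧ ∀ v : P, ∃ γ ∈ Γ.toSubmodule, projInt hPN γ ∈ U ∧
      ‖projPhys hPN γ - v‖ ≤ D := by
  obtain ⟨R, hR⟩ := Γ.exists_covering_radius
  obtain ⟨u, hu⟩ := hne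
  let Q : E →L[ℝ] P := LinearMap.toContinuousLinearMap (projPhys hPN)
  let I : E →L[ℝ] N := LinearMap.toContinuousLinearMap (projInt hPN)
  have hR0 : 0 ≤ R := by
    obtain ⟨γ, -, h⟩ := hR 0
    exact (norm_nonneg _).trans h
  have hcover : Metric.closedBall u (‖I‖ * R) ⊆
      ⋃ γ : Γ.toSubmodule, (fun y => y + projInt hPN γ) ⁻¹' U := by
    intro y _
    have hopen : IsOpen ((fun x => y + x) ⁻¹' U) := hU.preimage (by fun_prop)
    obtain ⟨_, ⟨γ, hγ, rfl⟩, hx⟩ := hdense.exists_mem_open hopen ⟨-y + u, by simpa using hu⟩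
    exact Set.mem_iUnion.2 ⟨⟨γ, hγ⟩, hx⟩
  obtain ⟨t, ht⟩ := (isCompact_closedBall u (‖I‖ * R)).elim_finite_subcover _
    (fun γ => hU.preimage (by fun_prop)) hcover
  refine ⟨‖Q‖ * R + ∑ γ ∈ t, ‖projPhys hPN γ‖, by positivity, fun v => ?_⟩
  obtain ⟨γ, hγ, hγR⟩ := hR ((v : E) + (u : E))
  have hQ : projPhys hPN ((v : E) + (u : E)) = v := by
    rw [map_add, projPhys, Submodule.projectionOnto_apply_left,
      Submodule.projectionOnto_apply_right, add_zero]
  have hI : projInt hPN ((v : E) + (u : E)) = u := by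
    rw [map_add, projInt, Submodule.projectionOnto_apply_left,
      Submodule.projectionOnto_apply_right, zero_add]
  have h1 : ‖projPhys hPN γ - v‖ ≤ ‖Q‖ * R := by
    rw [← hQ, ← map_sub]
    exact (Q.le_opNorm _).trans (mul_le_mul_of_nonneg_left hγR (norm_nonneg _))
  have h2 : projInt hPN γ ∈ Metric.closedBall u (‖I‖ * R) := by
    rw [mem_closedBall_iff_norm, ← hI, ← map_sub]
    exact (I.le_opNorm _).trans (mul_le_mul_of_nonneg_left hγR (norm_nonneg _))
  obtain ⟨γ', hγ't, hγ'⟩ := Set.mem_iUnion₂.1 (ht h2)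
  refine ⟨γ + γ', Γ.toSubmodule.add_mem hγ γ'.2, by rw [map_add]; exact hγ', ?_⟩
  have h3 : ‖projPhys hPN γ'‖ ≤ ∑ γ ∈ t, ‖projPhys hPN (γ : E)‖ :=
    Finset.single_le_sum (f := fun γ : Γ.toSubmodule => ‖projPhys hPN (γ : E)‖)
      (fun _ _ => norm_nonneg _) hγ't
  calc ‖projPhys hPN (γ + γ') - v‖ = ‖(projPhys hPN γ - v) + projPhys hPN γ'‖ := by
        rw [map_add]
        congr 1
        abel
    _ ≤ _ := (norm_add_le _ _).trans (add_le_add h1 h3)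

/-- If the lattice projects densely to the internal space, a cylinder of radius `r` over an open set
contains at least `c * r ^ d` lattice points. -/
theorem exists_le_card_latticeCylinder (hPN : IsCompl P N) (Γ : LatticeSpace E)
    (hdense : Dense (projInt hPN '' (Γ.toSubmodule : Set E))) {U : Set N} (hU : IsOpen U)
    (hne : U.Nonempty) :
    ∃ c : ℝ, 0 < c ∧ ∀ᶠ r : ℝ in atTop, ∃ T : Finset E,
      (T : Set E) ⊆ latticeCylinder hPN Γ U r ∧ c * r ^ finrank ℝ P ≤ T.card := by
  classical
  obtain ⟨D, hD, hrel⟩ := exists_relativelyDense hPN Γ hdense hU hne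
  let e : P ≃L[ℝ] (Fin (finrank ℝ P) → ℝ) := ContinuousLinearEquiv.ofFinrankEq (by simp)
  -- on a grid of this mesh, the lattice points near distinct grid points are distinct
  set a : ℝ := ‖(e : P →L[ℝ] (Fin (finrank ℝ P) → ℝ))‖ * (2 * D) + 1
  have ha : 0 < a := by positivity
  let v : (Fin (finrank ℝ P) → ℕ) → P := fun z => e.symm fun i => a * z i
  choose g hgΓ hgU hgD using fun z => hrel (v z)
  have hginj : Function.Injective g := by
    intro z w hzw
    by_contra hne
    obtain ⟨i, hi⟩ := Function.ne_iff.1 hne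
    have h1 : ‖v z - v w‖ ≤ 2 * D := by
      have h2 := hgD z
      rw [hzw, norm_sub_rev] at h2
      calc ‖v z - v w‖ = ‖(v z - projPhys hPN (g w)) + (projPhys hPN (g w) - v w)‖ := by
            rw [sub_add_sub_cancel]
        _ ≤ ‖v z - projPhys hPN (g w)‖ + ‖projPhys hPN (g w) - v w‖ := norm_add_le _ _
        _ ≤ 2 * D := by linarith [hgD w]
    have h3 : ‖e (v z - v w)‖ < a := by
      refine ((e : P →L[ℝ] (Fin (finrank ℝ P) → ℝ)).le_opNorm _).trans_lt ?_
      exact (mul_le_mul_of_nonneg_left h1 (norm_nonneg _)).trans_lt (lt_add_one _)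
    have h4 : |a * (z i : ℝ) - a * (w i : ℝ)| ≤ ‖e (v z - v w)‖ := by
      have := norm_le_pi_norm (e (v z - v w)) i
      simpa [v, map_sub] using this
    have h5 : (1 : ℝ) ≤ |(z i : ℝ) - (w i : ℝ)| := by
      have : (1 : ℤ) ≤ |(z i : ℤ) - (w i : ℤ)| :=
        Int.one_le_abs (sub_ne_zero.2 (by exact_mod_cast hi))
      exact_mod_cast this
    rw [← mul_sub, abs_mul, abs_of_pos ha] at h4
    nlinarith
  set B : ℝ := ‖(e.symm : (Fin (finrank ℝ P) → ℝ) →L[ℝ] P)‖ * a + 1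
  have hB : 0 < B := by positivity
  refine ⟨(1 / (2 * B)) ^ finrank ℝ P, by positivity, ?_⟩
  filter_upwards [eventually_ge_atTop (2 * D), eventually_ge_atTop 0] with r hr hr0
  set L : ℕ := ⌊(r - D) / B⌋₊
  have hL : B * L ≤ r - D := by
    have : (L : ℝ) ≤ (r - D) / B := Nat.floor_le (div_nonneg (by linarith) hB.le)
    rw [le_div_iff₀ hB] at this
    linarith
  refine ⟨(Fintype.piFinset fun _ : Fin (finrank ℝ P) => Finset.range (L + 1)).image g, ?_, ?_⟩
  · intro γ hγ
    obtain ⟨z, hz, rfl⟩ := Finset.mem_image.1 (Finset.mem_coe.1 hγ)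
    refine ⟨hgΓ z, ?_, hgU z⟩
    have hv : ‖v z‖ ≤ B * L := by
      have h1 : ‖fun i => a * (z i : ℝ)‖ ≤ a * L := by
        rw [pi_norm_le_iff_of_nonneg (by positivity)]
        intro i
        have hzi : z i ≤ L := by
          have := Finset.mem_range.1 (Fintype.mem_piFinset.1 hz i)
          omega
        rw [Real.norm_of_nonneg (by positivity)]
        exact mul_le_mul_of_nonneg_left (by exact_mod_cast hzi) ha.le
      calc ‖v z‖ ≤ ‖(e.symm : (Fin (finrank ℝ P) → ℝ) →L[ℝ] P)‖ * ‖fun i => a * (z i : ℝ)‖ :=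
            (e.symm : (Fin (finrank ℝ P) → ℝ) →L[ℝ] P).le_opNorm _
        _ ≤ ‖(e.symm : (Fin (finrank ℝ P) → ℝ) →L[ℝ] P)‖ * (a * L) :=
            mul_le_mul_of_nonneg_left h1 (ContinuousLinearMap.opNorm_nonneg _)
        _ ≤ B * L := by
            rw [← mul_assoc]
            exact mul_le_mul_of_nonneg_right (by simp [B]) (Nat.cast_nonneg _)
    have h2 := norm_sub_norm_le (projPhys hPN (g z)) (v z)
    linarith [hgD z]
  · rw [Finset.card_image_of_injective _ hginj, Fintype.card_piFinset_const, Finset.card_range,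
      ← mul_pow, Nat.cast_pow]
    refine pow_le_pow_left₀ (by positivity) ?_ _
    have h1 : (r - D) / B < L + 1 := Nat.lt_floor_add_one _
    push_cast
    refine le_trans ?_ h1.le
    rw [le_div_iff₀ hB]
    field_simp
    linarith

end LatticeCounting

/-! ### Patches of cut and project sets -/

section Patches

variable {E : Type*} [NormedAddCommGroup E] [InnerProductSpace ℝ E]
  {P N : Submodule ℝ E}

/-- The patch at the image of a lift `γ₀ + s` consists of the `γ_∨` for which the translate of the
internal coordinate of the lift by `γ_<` stays in the window. -/
theorem centredPatch_cutAndProject (hPN : IsCompl P N) (Γ : LatticeSpace E) (W : Set N) (s : E)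
    {γ₀ : E} (hγ₀ : γ₀ ∈ Γ.toSubmodule) (r : ℝ) :
    centredPatch (cutAndProject hPN Γ W s) (projPhys hPN (γ₀ + s)) r =
      projPhys hPN '' {γ | γ ∈ Γ.toSubmodule ∧ ‖projPhys hPN γ‖ ≤ r ∧
        projInt hPN (γ₀ + s) + projInt hPN γ ∈ W} := by
  ext v
  constructor
  · rintro ⟨_, ⟨⟨γ', hγ', hW', rfl⟩, hball⟩, rfl⟩
    have h : projPhys hPN (γ' - γ₀) = projPhys hPN (γ' + s) - projPhys hPN (γ₀ + s) := by
      rw [← map_sub, add_sub_add_right_eq_sub]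
    refine ⟨γ' - γ₀, ⟨Γ.toSubmodule.sub_mem hγ' hγ₀, ?_, ?_⟩, h⟩
    · rwa [h, ← mem_closedBall_iff_norm]
    · rw [← map_add, show γ₀ + s + (γ' - γ₀) = γ' + s by abel]
      exact hW'
  · rintro ⟨γ, ⟨hγ, hr, hW'⟩, rfl⟩
    have h : projPhys hPN (γ₀ + γ + s) = projPhys hPN (γ₀ + s) + projPhys hPN γ := by
      rw [← map_add, add_right_comm]
    refine ⟨projPhys hPN (γ₀ + γ + s), ⟨⟨γ₀ + γ, Γ.toSubmodule.add_mem hγ₀ hγ, ?_, rfl⟩, ?_⟩, ?_⟩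
    · rwa [add_right_comm, map_add]
    · rw [h, mem_closedBall_iff_norm, add_sub_cancel_left]
      exact hr
    · simp only [h, add_sub_cancel_left]

variable [FiniteDimensional ℝ E]

/-- A patch is determined by which of the half-spaces `S - γ_<` contain the internal coordinate of
its centre, with `S` a facet half-space and `γ` in a lattice cylinder over `W - W`. -/
theorem patchClasses_finite_and_ncard_le (hPN : IsCompl P N) (Γ : LatticeSpace E) {W : Set N}
    {𝓢 : Set (Set N)} (hW : IsPolytopalWindow W 𝓢) (s : E) (r : ℝ) :
    (patchClasses (cutAndProject hPN Γ W s) r).Finite ∧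
      complexity (cutAndProject hPN Γ W s) r ≤
        ((latticeCylinder hPN Γ (W - W) r).ncard * 𝓢.ncard + 1) ^ finrank ℝ N := by
  classical
  set F := latticeCylinder hPN Γ (W - W) r
  have hF : F.Finite :=
    finite_latticeCylinder hPN Γ (hW.isCompact.isBounded.sub hW.isCompact.isBounded) r
  have := hF.fintype
  have := hW.finite.fintype
  choose η α hη hηα using fun S : 𝓢 => hW.isHalfSpace S S.2
  let f : F × 𝓢 → Dual ℝ N := fun i => (innerSL ℝ (η i.2) : N →ₗ[ℝ] ℝ)
  let c : F × 𝓢 → ℝ := fun i => inner ℝ (η i.2) (α i.2) - inner ℝ (η i.2) (projInt hPN i.1)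
  have hmem : ∀ (i : F × 𝓢) (y : N), c i ≤ f i y ↔ y + projInt hPN i.1 ∈ (i.2 : Set N) := by
    intro i y
    have : y + projInt hPN i.1 ∈ (i.2 : Set N) ↔
        y + projInt hPN i.1 ∈ halfSpace (η i.2) (α i.2) := by rw [← hηα]
    rw [this, mem_halfSpace_iff, inner_add_right]
    exact sub_le_iff_le_add
  let decode : Set (F × 𝓢) → Set P := fun A =>
    projPhys hPN '' {γ | ∃ h : γ ∈ F, ∀ S : 𝓢, (⟨γ, h⟩, S) ∈ A}
  have hsub : patchClasses (cutAndProject hPN Γ W s) r ⊆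
      decode '' Set.range fun y : N => {i | c i ≤ f i y} := by
    rintro _ ⟨_, ⟨γ₀, hγ₀, hγ₀W, rfl⟩, rfl⟩
    refine ⟨_, ⟨projInt hPN (γ₀ + s), rfl⟩, ?_⟩
    simp only
    rw [centredPatch_cutAndProject hPN Γ W s hγ₀ r]
    simp only [decode]
    congr 1
    ext γ
    simp only [Set.mem_ofPred_eq, hmem]
    constructor
    · rintro ⟨h, hS⟩
      refine ⟨h.1, h.2.1, ?_⟩
      rw [← hW.sInter_eq]
      exact fun S hS' => hS ⟨S, hS'⟩
    · rintro ⟨h1, h2, h3⟩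
      refine ⟨⟨h1, h2, projInt hPN (γ₀ + s) + projInt hPN γ, h3, _, hγ₀W,
        add_sub_cancel_left _ _⟩, fun S => ?_⟩
      rw [← hW.sInter_eq] at h3
      exact h3 S S.2
  have hfin : (Set.range fun y : N => {i | c i ≤ f i y}).Finite := Set.toFinite _
  refine ⟨(hfin.image decode).subset hsub, ?_⟩
  have hcard : Fintype.card (F × 𝓢) = F.ncard * 𝓢.ncard := by
    rw [Fintype.card_prod, ← Nat.card_eq_fintype_card, ← Nat.card_eq_fintype_card]
    rfl
  calc complexity (cutAndProject hPN Γ W s) r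
      ≤ (decode '' Set.range fun y : N => {i | c i ≤ f i y}).ncard :=
        Set.ncard_le_ncard hsub (hfin.image decode)
    _ ≤ (Set.range fun y : N => {i | c i ≤ f i y}).ncard := Set.ncard_image_le hfin
    _ ≤ _ := by
        rw [← hcard]
        exact ncard_halfSpace_patterns_le f c

theorem exists_complexity_le (hPN : IsCompl P N) (Γ : LatticeSpace E) {W : Set N}
    {𝓢 : Set (Set N)} (hW : IsPolytopalWindow W 𝓢) (s : E) :
    ∃ C : ℝ, ∀ r : ℝ, 1 ≤ r →
      (complexity (cutAndProject hPN Γ W s) r : ℝ) ≤ C * (r ^ finrank ℝ P) ^ finrank ℝ N := by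
  obtain ⟨C, hC0, hC⟩ := exists_ncard_latticeCylinder_le hPN Γ
    (hW.isCompact.isBounded.sub hW.isCompact.isBounded)
  refine ⟨(C * 𝓢.ncard + 1) ^ finrank ℝ N, fun r hr => ?_⟩
  have h1 : (complexity (cutAndProject hPN Γ W s) r : ℝ) ≤
      ((latticeCylinder hPN Γ (W - W) r).ncard * 𝓢.ncard + 1 : ℝ) ^ finrank ℝ N := by
    exact_mod_cast (patchClasses_finite_and_ncard_le hPN Γ hW s r).2
  refine h1.trans ?_
  rw [← mul_pow]
  refine pow_le_pow_left₀ (by positivity) ?_ _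
  have h2 := mul_le_mul_of_nonneg_right (hC r hr) (Nat.cast_nonneg (α := ℝ) 𝓢.ncard)
  have h3 : (1 : ℝ) ≤ r ^ finrank ℝ P := one_le_pow₀ hr
  nlinarith

/-- The lower bound on the complexity. The cells of a grid in a small box around an interior point
`q` of the window carry distinct patches. In direction `i` the grid lines are the translates of the
`i`-th facet hyperplane by the `-γ_<` for which the translated facet, and no other part of the
boundary of the translated window, passes near `q`. Distinct lattice points give distinct grid lines
as no nonzero `γ_<` is parallel to a facet. -/
theorem exists_le_complexity (hPN : IsCompl P N) (Γ : LatticeSpace E) {W : Set N}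
    {𝓢 : Set (Set N)} (hW : IsPolytopalWindow W 𝓢) (s : E)
    (hinj : Set.InjOn (projPhys hPN) (Γ.toSubmodule : Set E))
    (hdense : Dense (projInt hPN '' (Γ.toSubmodule : Set E)))
    (hstab : ∀ η α : N, η ≠ 0 → halfSpace η α ∈ 𝓢 →
      ∀ γ ∈ Γ.toSubmodule, inner ℝ η (projInt hPN γ) = 0 → γ = 0) :
    ∃ c : ℝ, 0 < c ∧ ∀ᶠ r : ℝ in atTop,
      c * (r ^ finrank ℝ P) ^ finrank ℝ N ≤ complexity (cutAndProject hPN Γ W s) r := by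
  classical
  obtain ⟨η, α, Φ, hηα, hΦ⟩ := hW.exists_coordinates
  choose p hpη hpW using fun i => hW.exists_facet_point (hηα i).1 (hηα i).2
  obtain ⟨q, hq⟩ := hW.interior_nonempty
  -- near `q`, translation by a vector close to `p i - q` leads to the vicinity of `p i`
  have hnear : ∀ i, ∃ A V : Set N, IsOpen A ∧ q ∈ A ∧ IsOpen V ∧ p i - q ∈ V ∧
      ∀ y ∈ A, ∀ u ∈ V, (y + u ∈ W ↔ y + u ∈ halfSpace (η i) (α i)) := by
    intro i
    have hcont : Tendsto (fun z : N × N => z.1 + z.2) (𝓝 (q, p i - q)) (𝓝 (p i)) := by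
      have : Continuous fun z : N × N => z.1 + z.2 := continuous_add
      simpa using this.tendsto (q, p i - q)
    obtain ⟨A, V, hA, hqA, hV, hpV, hAV⟩ := mem_nhds_prod_iff'.1 (hcont.eventually (hpW i))
    exact ⟨A, V, hA, hqA, hV, hpV, fun y hy u hu => hAV (Set.mk_mem_prod hy hu)⟩
  choose A V hAo hqA hVo hpV hAV using hnear
  obtain ⟨δ, hδ, hbox⟩ : ∃ δ > 0, ∀ y : N, (∀ i, |Φ y i - Φ q i| < δ) →
      y ∈ W ∧ ∀ i, y ∈ A i := by
    have hnhds : interior W ∩ ⋂ i, A i ∈ 𝓝 (Φ.symm (Φ q)) := by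
      rw [ContinuousLinearEquiv.symm_apply_apply]
      exact inter_mem (isOpen_interior.mem_nhds hq)
        ((isOpen_iInter_of_finite hAo).mem_nhds (Set.mem_iInter.2 hqA))
    obtain ⟨δ, hδ, hball⟩ := Metric.mem_nhds_iff.1 (Φ.symm.continuous.continuousAt hnhds)
    refine ⟨δ, hδ, fun y hy => ?_⟩
    have hmem : Φ y ∈ Metric.ball (Φ q) δ := by
      rw [Metric.mem_ball, dist_pi_lt_iff hδ]
      exact fun i => by rw [Real.dist_eq]; exact hy i
    have := hball hmem
    rw [Set.mem_preimage, ContinuousLinearEquiv.symm_apply_apply] at this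
    exact ⟨interior_subset this.1, Set.mem_iInter.1 this.2⟩
  -- the translates of the `i`-th facet that pass near `q`
  have hcount : ∀ i, ∃ c : ℝ, 0 < c ∧ ∀ᶠ r : ℝ in atTop, ∃ T : Finset E,
      (T : Set E) ⊆ latticeCylinder hPN Γ
        (V i ∩ {u | |inner ℝ (η i) (p i - q) - inner ℝ (η i) u| < δ}) r ∧
      c * r ^ finrank ℝ P ≤ T.card := by
    intro i
    refine exists_le_card_latticeCylinder hPN Γ hdense
      ((hVo i).inter (isOpen_lt (by fun_prop) continuous_const)) ⟨p i - q, hpV i, ?_⟩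
    simpa using hδ
  choose c hc hT using hcount
  refine ⟨∏ i, c i, Finset.prod_pos fun i _ => hc i, ?_⟩
  filter_upwards [eventually_all.2 hT, eventually_ge_atTop 0] with r hr hr0
  choose T hTsub hTcard using hr
  let τ : Fin (finrank ℝ N) → E → ℝ := fun i γ =>
    inner ℝ (η i) (α i) - inner ℝ (η i) (projInt hPN γ)
  have hτinj : ∀ i, ∀ γ ∈ T i, ∀ γ' ∈ T i, τ i γ = τ i γ' → γ = γ' := by
    intro i γ hγ γ' hγ' h
    refine sub_eq_zero.1 (hstab (η i) (α i) (hηα i).1 (hηα i).2 _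
      (Γ.toSubmodule.sub_mem (hTsub i hγ).1 (hTsub i hγ').1) ?_)
    rw [map_sub, inner_sub_right]
    simp only [τ] at h
    linarith
  have hτδ : ∀ i, ∀ γ ∈ T i, |τ i γ - Φ q i| < δ := by
    intro i γ hγ
    have : |inner ℝ (η i) (p i - q) - inner ℝ (η i) (projInt hPN γ)| < δ := (hTsub i hγ).2.2.2
    rw [inner_sub_right, hpη] at this
    rw [hΦ]
    simp only [τ]
    rwa [sub_right_comm]
  -- the end of the grid interval that starts at the grid line of `γ`
  have hnext : ∀ i, ∀ γ : T i, ∃ u, τ i γ < u ∧ u ≤ Φ q i + δ ∧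
      ∀ γ' ∈ T i, τ i γ < τ i γ' → u ≤ τ i γ' := by
    intro i γ
    have h1 : ∀ᶠ u in 𝓝[>] (τ i γ), ∀ γ' ∈ T i, τ i γ < τ i γ' → u ≤ τ i γ' := by
      rw [Finset.eventually_all]
      intro γ' _
      by_cases h : τ i γ < τ i γ'
      · filter_upwards [Ioo_mem_nhdsGT h] with u hu _ using hu.2.le
      · exact Eventually.of_forall fun u h' => absurd h' h
    have h2 : τ i γ < Φ q i + δ := by linarith [(abs_lt.1 (hτδ i γ γ.2)).2]
    obtain ⟨u, hu1, hu2, hu3⟩ :=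
      (h1.and ((eventually_mem_set.2 (Ioo_mem_nhdsGT h2)).and
        (eventually_mem_set.2 self_mem_nhdsWithin))).exists
    exact ⟨u, hu3, hu2.2.le, hu1⟩
  choose u hu1 hu2 hu3 using hnext
  -- every grid cell contains the internal coordinate of a point of `Γ + s`
  have hcell : ∀ κ : (∀ i, T i), ∃ γ ∈ Γ.toSubmodule,
      ∀ i, τ i (κ i) < Φ (projInt hPN (γ + s)) i ∧ Φ (projInt hPN (γ + s)) i < u i (κ i) := by
    intro κ
    have hopen : IsOpen {y : N | ∀ i, τ i (κ i) < Φ (y + projInt hPN s) i ∧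
        Φ (y + projInt hPN s) i < u i (κ i)} := by
      have hcont : ∀ i, Continuous fun y : N => Φ (y + projInt hPN s) i := fun i =>
        (continuous_apply i).comp (Φ.continuous.comp (continuous_id.add continuous_const))
      rw [Set.ofPred_forall]
      exact isOpen_iInter_of_finite fun i =>
        (isOpen_lt continuous_const (hcont i)).inter (isOpen_lt (hcont i) continuous_const)
    obtain ⟨_, ⟨γ, hγ, rfl⟩, h⟩ := hdense.exists_mem_open hopen
      ⟨Φ.symm (fun i => (τ i (κ i) + u i (κ i)) / 2) - projInt hPN s, fun i => by
        rw [sub_add_cancel, ContinuousLinearEquiv.apply_symm_apply]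
        have := hu1 i (κ i)
        constructor <;> linarith⟩
    refine ⟨γ, hγ, fun i => ?_⟩
    rw [map_add]
    exact h i
  choose g hgΓ hg using hcell
  have hgbox : ∀ κ, projInt hPN (g κ + s) ∈ W ∧ ∀ i, projInt hPN (g κ + s) ∈ A i := by
    intro κ
    refine hbox _ fun i => ?_
    have h1 := hg κ i
    have h2 := hu2 i (κ i)
    have h3 := (abs_lt.1 (hτδ i (κ i) (κ i).2)).1
    rw [abs_lt]
    constructor <;> linarith [h1.1, h1.2]
  have hside : ∀ κ i, ∀ γ ∈ T i, projInt hPN (g κ + s) + projInt hPN γ ∈ W ↔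
      τ i γ ≤ Φ (projInt hPN (g κ + s)) i := by
    intro κ i γ hγ
    rw [hAV i _ ((hgbox κ).2 i) _ (hTsub i hγ).2.2.1, mem_halfSpace_iff, inner_add_right, hΦ]
    exact sub_le_iff_le_add.symm
  let patch : (∀ i, T i) → Set P := fun κ =>
    centredPatch (cutAndProject hPN Γ W s) (projPhys hPN (g κ + s)) r
  have hkey : ∀ κ κ' i, τ i (κ i) < τ i (κ' i) → patch κ ≠ patch κ' := by
    intro κ κ' i hlt heq
    have hκ' := hTsub i (κ' i).2
    have h1 : projPhys hPN (κ' i : E) ∈ patch κ' := by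
      simp only [patch]
      rw [centredPatch_cutAndProject hPN Γ W s (hgΓ κ') r]
      exact ⟨_, ⟨hκ'.1, hκ'.2.1, (hside κ' i _ (κ' i).2).2 (hg κ' i).1.le⟩, rfl⟩
    rw [← heq] at h1
    simp only [patch] at h1
    rw [centredPatch_cutAndProject hPN Γ W s (hgΓ κ) r] at h1
    obtain ⟨γ, ⟨hγ, -, hγW⟩, hγeq⟩ := h1
    obtain rfl := hinj hγ hκ'.1 hγeq
    have h2 := (hside κ i _ (κ' i).2).1 hγW
    have h3 := hu3 i (κ i) _ (κ' i).2 hlt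
    linarith [(hg κ i).2]
  have hpinj : Function.Injective patch := by
    intro κ κ' heq
    by_contra hne
    obtain ⟨i, hi⟩ := Function.ne_iff.1 hne
    have hτne : τ i (κ i) ≠ τ i (κ' i) := fun h =>
      hi (Subtype.ext (hτinj i _ (κ i).2 _ (κ' i).2 h))
    rcases lt_or_gt_of_ne hτne with h | h
    · exact hkey κ κ' i h heq
    · exact hkey κ' κ i h heq.symm
  have hsub : Set.range patch ⊆ patchClasses (cutAndProject hPN Γ W s) r := by
    rintro _ ⟨κ, rfl⟩
    exact ⟨_, ⟨g κ, hgΓ κ, (hgbox κ).1, rfl⟩, rfl⟩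
  have hle : ∏ i, (T i).card ≤ complexity (cutAndProject hPN Γ W s) r := by
    have h1 := Set.ncard_le_ncard hsub (patchClasses_finite_and_ncard_le hPN Γ hW s r).1
    have h2 : (Set.range patch).ncard = ∏ i, (T i).card := by
      rw [← Set.image_univ, Set.ncard_image_of_injective _ hpinj, Set.ncard_univ,
        Nat.card_eq_fintype_card, Fintype.card_pi]
      simp
    rw [← h2]
    exact h1
  calc (∏ i, c i) * (r ^ finrank ℝ P) ^ finrank ℝ N
      = ∏ i, (c i * r ^ finrank ℝ P) := by
        rw [Finset.prod_mul_distrib, Finset.prod_const, Finset.card_univ, Fintype.card_fin]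
    _ ≤ ∏ i, ((T i).card : ℝ) :=
        Finset.prod_le_prod (fun i _ => mul_nonneg (hc i).le (by positivity)) fun i _ => hTcard i
    _ ≤ _ := by exact_mod_cast hle

end Patches

/-! ### Generic lattices -/

section Generic

variable {E : Type*} [NormedAddCommGroup E] [InnerProductSpace ℝ E]
  {P N : Submodule ℝ E}

theorem surjective_projInt (hPN : IsCompl P N) : Function.Surjective (projInt hPN) :=
  Submodule.projectionOnto_surjective hPN.symm

theorem latticeStabiliser_eq_bot (hPN : IsCompl P N) (Γ : LatticeSpace E) {η α : N}
    (h : ∀ γ ∈ Γ.toSubmodule, inner ℝ η (projInt hPN γ) = 0 → γ = 0) :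
    latticeStabiliser hPN Γ (affineHyperplane η α) = ⊥ := by
  rw [eq_bot_iff]
  rintro γ ⟨hγ, hstab⟩
  refine h γ hγ ?_
  have h1 : projInt hPN γ +ᵥ affineHyperplane η α = affineHyperplane η α := hstab
  have h2 : projInt hPN γ +ᵥ α ∈ projInt hPN γ +ᵥ affineHyperplane η α :=
    Set.vadd_mem_vadd_set (mem_affineHyperplane_iff.2 rfl)
  rw [h1, vadd_eq_add, mem_affineHyperplane_iff, inner_add_right] at h2
  linarith

variable [FiniteDimensional ℝ E]

theorem IsHaarOnLattices.ae_injOn_projPhys {μ : Measure (LatticeSpace E)}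
    (hμ : IsHaarOnLattices μ) (hPN : IsCompl P N) (hP : P ≠ ⊥) :
    ∀ᵐ Γ : LatticeSpace E ∂μ, Set.InjOn (projPhys hPN) (Γ.toSubmodule : Set E) := by
  obtain ⟨v, hvP, hv⟩ := Submodule.exists_mem_ne_zero_of_ne_bot hP
  -- a hyperplane that contains the internal space
  let ψ : Dual ℝ E := (innerSL ℝ (⟨v, hvP⟩ : P) : P →ₗ[ℝ] ℝ).comp (projPhys hPN)
  have hψ : ψ ≠ 0 := by
    intro h
    have h1 : projPhys hPN v = ⟨v, hvP⟩ := Submodule.projectionOnto_apply_left hPN ⟨v, hvP⟩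
    have h2 : ψ v = 0 := by rw [h]; rfl
    have h3 : inner ℝ (⟨v, hvP⟩ : P) (⟨v, hvP⟩ : P) = 0 := by
      rw [← h2]
      simp [ψ, h1]
    exact hv (congrArg Subtype.val (inner_self_eq_zero.1 h3))
  filter_upwards [hμ.ae_forall_eq_zero hψ] with Γ hΓ x hx y hy hxy
  refine sub_eq_zero.1 (hΓ _ (Γ.toSubmodule.sub_mem hx hy) ?_)
  have : projPhys hPN (x - y) = 0 := by rw [map_sub, hxy, sub_self]
  simp [ψ, this]

theorem IsHaarOnLattices.ae_dense_projInt {μ : Measure (LatticeSpace E)}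
    (hμ : IsHaarOnLattices μ) (hPN : IsCompl P N) (hP : P ≠ ⊥) :
    ∀ᵐ Γ : LatticeSpace E ∂μ, Dense (projInt hPN '' (Γ.toSubmodule : Set E)) := by
  obtain ⟨v, hvP, hv⟩ := Submodule.exists_mem_ne_zero_of_ne_bot hP
  filter_upwards [hμ.ae_forall_functional_eq_zero hv] with Γ hΓ
  let G : AddSubgroup N := Γ.toSubmodule.toAddSubgroup.map (projInt hPN).toAddMonoidHom
  have hG : (G : Set N) = projInt hPN '' (Γ.toSubmodule : Set E) := rfl
  rw [← hG]
  refine AddSubgroup.dense_of_forall_functional ?_ fun φ hφ => ?_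
  · have := Γ.isZLattice.span_top
    rw [hG, ← Submodule.map_span, this, Submodule.map_top, LinearMap.range_eq_top]
    exact surjective_projInt hPN
  · have h := hΓ (LinearMap.toContinuousLinearMap (φ.comp (projInt hPN)))
      (fun γ hγ => hφ _ ⟨γ, hγ, rfl⟩) (by
        have : projInt hPN v = 0 := Submodule.projectionOnto_apply_right hPN.symm ⟨v, hvP⟩
        simp [this])
    ext x
    obtain ⟨y, rfl⟩ := surjective_projInt hPN x
    exact congrArg (fun χ : E →L[ℝ] ℝ => χ y) h

theorem IsHaarOnLattices.ae_forall_inner_projInt {μ : Measure (LatticeSpace E)}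
    (hμ : IsHaarOnLattices μ) (hPN : IsCompl P N) {η : N} (hη : η ≠ 0) :
    ∀ᵐ Γ : LatticeSpace E ∂μ,
      ∀ γ ∈ Γ.toSubmodule, inner ℝ η (projInt hPN γ) = 0 → γ = 0 := by
  let ψ : Dual ℝ E := (innerSL ℝ η : N →ₗ[ℝ] ℝ).comp (projInt hPN)
  have hψ : ψ ≠ 0 := by
    intro h
    obtain ⟨x, hx⟩ := surjective_projInt hPN η
    have h2 : ψ x = 0 := by rw [h]; rfl
    have h3 : inner ℝ η η = 0 := by
      rw [← h2]
      simp [ψ, hx]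
    exact hη (inner_self_eq_zero.1 h3)
  exact hμ.ae_forall_eq_zero hψ

/-- For almost every lattice, no nonzero lattice point is parallel to a facet of the window. A
half-space determines its bounding hyperplane, so finitely many normals account for all
presentations of the facet half-spaces. -/
theorem IsHaarOnLattices.ae_forall_facet {μ : Measure (LatticeSpace E)}
    (hμ : IsHaarOnLattices μ) (hPN : IsCompl P N) {W : Set N} {𝓢 : Set (Set N)}
    (hW : IsPolytopalWindow W 𝓢) :
    ∀ᵐ Γ : LatticeSpace E ∂μ, ∀ η α : N, η ≠ 0 → halfSpace η α ∈ 𝓢 →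
      ∀ γ ∈ Γ.toSubmodule, inner ℝ η (projInt hPN γ) = 0 → γ = 0 := by
  choose η α hη hηα using fun S : 𝓢 => hW.isHalfSpace S S.2
  have : Finite 𝓢 := hW.finite
  filter_upwards [ae_all_iff.2 fun S => hμ.ae_forall_inner_projInt hPN (hη S)]
    with Γ hΓ η' α' hη' hS γ hγ hγη
  refine hΓ ⟨_, hS⟩ γ hγ ?_
  have h1 : affineHyperplane η' α' = affineHyperplane (η ⟨_, hS⟩) (α ⟨_, hS⟩) := by
    rw [← frontier_halfSpace_eq hη', ← frontier_halfSpace_eq (hη ⟨_, hS⟩), ← hηα]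
  have h2 : α' ∈ affineHyperplane η' α' := mem_affineHyperplane_iff.2 rfl
  have h3 : α' + projInt hPN γ ∈ affineHyperplane η' α' := by
    rw [mem_affineHyperplane_iff, inner_add_right, hγη, add_zero]
  rw [h1, mem_affineHyperplane_iff] at h2 h3
  rw [inner_add_right, h2] at h3
  linarith

end Generic

theorem mainTheorem8 {E : Type*} [NormedAddCommGroup E] [InnerProductSpace ℝ E]
    [FiniteDimensional ℝ E] (P N : Submodule ℝ E) (hPN : IsCompl P N) (k d : ℕ)
    (hk : finrank ℝ E = k) (hd : finrank ℝ P = d) (hd_pos : 0 < d) (hdk : d < k)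
    (W : Set N) (𝓢 : Set (Set N)) (hW : IsPolytopalWindow W 𝓢)
    (μ : Measure (LatticeSpace E)) (hμ : IsHaarOnLattices μ) :
    ∀ᵐ Γ : LatticeSpace E ∂μ,
      Set.InjOn (projPhys hPN) (Γ.toSubmodule : Set E) ∧
      Dense (projInt hPN '' (Γ.toSubmodule : Set E)) ∧
      (∀ H ∈ boundingHyperplanes 𝓢, latticeStabiliser hPN Γ H = ⊥) ∧
      ∀ s : E, IsNonsingular hPN Γ W s →
        (∀ r : ℝ, (patchClasses (cutAndProject hPN Γ W s) r).Finite) ∧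
        (fun r : ℝ => (complexity (cutAndProject hPN Γ W s) r : ℝ))
          =Θ[atTop] (fun r : ℝ => r ^ (d * (k - d))) := by
  have hP : P ≠ ⊥ := by
    rintro rfl
    rw [finrank_bot] at hd
    omega
  have hN : finrank ℝ N = k - d := by
    have := Submodule.finrank_add_eq_of_isCompl hPN
    omega
  filter_upwards [hμ.ae_injOn_projPhys hPN hP, hμ.ae_dense_projInt hPN hP,
    hμ.ae_forall_facet hPN hW] with Γ hinj hdense hfacet
  refine ⟨hinj, hdense, ?_, fun s _ => ⟨fun r =>
    (patchClasses_finite_and_ncard_le hPN Γ hW s r).1, ?_⟩⟩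
  · rintro _ ⟨η, α, hη, hS, rfl⟩
    exact latticeStabiliser_eq_bot hPN Γ (hfacet η α hη hS)
  · obtain ⟨C, hC⟩ := exists_complexity_le hPN Γ hW s
    obtain ⟨c, hc, hcr⟩ := exists_le_complexity hPN Γ hW s hinj hdense hfacet
    simp only [hd, hN, ← pow_mul] at hC hcr
    refine ⟨Asymptotics.IsBigO.of_bound C ?_, Asymptotics.IsBigO.of_bound c⁻¹ ?_⟩
    · filter_upwards [eventually_ge_atTop 1] with r hr
      rw [Real.norm_of_nonneg (Nat.cast_nonneg _), Real.norm_of_nonneg (by positivity)]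
      exact hC r hr
    · filter_upwards [eventually_ge_atTop 0, hcr] with r hr h
      rw [Real.norm_of_nonneg (Nat.cast_nonneg _), Real.norm_of_nonneg (by positivity),
        ← div_eq_inv_mul, le_div_iff₀ hc, mul_comm]
      exact h
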